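/- Let $\Delta=\{x\in\mathbb R^k: x\ge 0,\ \sum_i x_i=1\}$. A randomized rounding scheme $\mathcal R$ (with $k$ terminals) is a random labeling $\ell:\Delta\to[k]$. The length of an edge $(x,y)\in\Delta\times\Delta$ is $\frac12\|x-y\|_1$; the edge is cut if $\ell(x)\ne\ell(y)$. The scheme provides the approximation factor $\alpha$ for Multiway Cut if, for every finite weighted graph with $k$ distinct terminals and every embedding $v\mapsto x_v\in\Delta$ of its vertices that puts terminal $t$ at the unit vector $\mathbf 1_t$ (a feasible solution of the CKR relaxation), the expected weight of the edges cut by $v\mapsto\ell(x_v)$ is at most $\alpha\cdot\frac12\sum_{(v,v')\in E}w_{v,v'}\|x_v-x_{v'}\|_1$. The cut density of $\mathcal R$ for edges of type $(i,j)$ at $x\in\Delta$ is $\limsup_{\epsilon\to0^+}\Pr[\ell(x)\ne\ell(x+\epsilon\mathbf 1_i-\epsilon\mathbf 1_j)]/\epsilon$ (over $\epsilon$ with $x+\epsilon\mathbf 1_i-\epsilon\mathbf 1_j\in\Delta$; $0$ if there are none). *Exponential Clocks:* draw independent $Z_1,\dots,Z_k\sim\mathrm{Exp}(1)$ and label $x$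 by $\arg\min_i Z_i/x_i$. *Single Threshold* with threshold distribution $\mu$ on $(0,1]$: draw $\theta\sim\mu$ and, independently, a uniformly random permutation $\sigma$ of the terminals; label $x$ by the first $\sigma(n)$, $n\le k-1$, with $x_{\sigma(n)}\ge\theta$, and by $\sigma(k)$ if there is none. The *combination* $\mathcal R_{k,p,\mu}$ uses Exponential Clocks with probability $p\in[0,1]$ and Single Threshold with distribution $\mu$ with probability $1-p$. For $k\ge5$ let $b=\sqrt5-2$, $\epsilon=(1-2b)/(k-2)$. For terminals $i\neq j$ consider edges $(v,v')$ with $v_i=u_i$, $v_j=u_j$, $v_l=(1-u_i-u_j)/(k-2)$ for $l\ne i,j$, and $v'=v-\epsilon\mathbf 1_i+\epsilon\mathbf 1_j$. Let $A_{ij}$ be the set of these edges with $u_i\in[3b,1]$, $u_j=0$; $B_{ij}$ those with $u_i+2u_j=3b$, $u_j\in[0,b]$; $C_{ij}$ the single edge with $u_i=1$, $u_j=0$. Let $D_k$ be the distribution over edges that picks a uniformly random ordered pair $(i,j)$, $i\ne j$, and then a uniformly random edge (with respect to the parameter $u_i$) of $A_{ij}$, of $B_{ij}$, or the edge $C_{ij}$,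 with probabilities $\frac{1-3b}{1-b}\bigl(1-\frac1{k-2}\bigr)$, $\frac{2b}{1-b}-\frac1{k-2}$ and $\frac{2(1-2b)}{(1-b)(k-2)}$ respectively. **Theorem.** No combination of Exponential Clocks and Single Threshold (with any threshold distribution) provides an approximation factor better than $\frac{3+\sqrt5}4$: for every real $0\le\alpha<\frac{3+\sqrt5}4$ there is $K$ such that for all $k\ge K$, all $p\in[0,1]$ and all probability measures $\mu$ on $(0,1]$, the scheme $\mathcal R_{k,p,\mu}$ does not provide the approximation factor $\alpha$. More precisely, for every $k\ge5$, $D_k$ is a probability distribution on edges of $\Delta$, and there is a constant $C$ such that for all $k\ge5$, all $p\in[0,1]$ and all $\mu$: 1. $\displaystyle \mathbb E_{(x,y)\sim D_k}\left[\frac{\Pr[\mathcal R_{k,p,\mu}\text{ cuts }(x,y)]}{\frac12\|x-y\|_1}\right]\ \ge\ \frac{3+\sqrt5}4-\frac Ck$; 2. if $\mathcal R_{k,p,\mu}$ provides the approximation factor $\alpha\ge0$, then $\alpha\ge\frac{3+\sqrt5}4-\frac Ck$; 3. if $\alpha\ge0$ and all cut densities of $\mathcal R_{k,p,\mu}$,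 for all types $(i,j)$ with $i\ne j$ and all $x\in\Delta$, are at most $\alpha$, then $\alpha\ge\frac{3+\sqrt5}4-\frac Ck$. -/

import Mathlib

open MeasureTheory Filter Topology
open scoped ENNReal NNReal

/-! ## The simplex, edges, and randomized rounding schemes -/

/-- The simplex `Δ = {x ∈ ℝ^k : x ≥ 0, ∑ x_i = 1}`; terminal `i` sits at the vertex `1_i`. -/
abbrev Simplex (k : ℕ) : Type := stdSimplex ℝ (Fin k)

/-- Half the `L¹`-distance of two vectors: the length of the edge between them. -/
noncomputable def edgeLength {k : ℕ} (x y : Fin k → ℝ) : ℝ :=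
  (1 / 2) * ∑ i, |x i - y i|

/-- A randomized rounding scheme with `k` terminals: a random labeling `ℓ : Δ → [k]`,
i.e. a family of labelings indexed by a probability space. -/
structure RoundingScheme (k : ℕ) where
  Ω : Type
  [mΩ : MeasurableSpace Ω]
  P : Measure Ω
  [isProb : IsProbabilityMeasure P]
  label : Ω → Simplex k → Fin k
  measurable_label : ∀ x, Measurable fun ω => label ω x

attribute [instance] RoundingScheme.mΩ RoundingScheme.isProb

namespace RoundingScheme

/-- `Pr[ℓ(x) ≠ ℓ(y)]`: the probability that the edge with endpoints `x`, `y` is cut. -/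
noncomputable def cutProb {k : ℕ} (R : RoundingScheme k) (x y : Simplex k) : ℝ≥0∞ :=
  R.P {ω | R.label ω x ≠ R.label ω y}

/-- The cut density for edges of type `(i,j)` at `x`:
`limsup_{ε → 0⁺} Pr[ℓ(x) ≠ ℓ(x + ε 1_i - ε 1_j)] / ε`, over those `ε > 0` for which
`x + ε 1_i - ε 1_j` is in the simplex (it is `0` when there are no such `ε`). -/
noncomputable def cutDensity {k : ℕ} (R : RoundingScheme k) (i j : Fin k) (x : Simplex k) :
    ℝ≥0∞ :=
  limsup
    (fun ε : {ε : ℝ // 0 < ε ∧ (x : Fin k → ℝ) + Pi.single i ε - Pi.single j ε ∈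
        stdSimplex ℝ (Fin k)} =>
      R.cutProb x ⟨(x : Fin k → ℝ) + Pi.single i ε.1 - Pi.single j ε.1, ε.2.2⟩ /
        ENNReal.ofReal ε.1)
    (comap Subtype.val (𝓝 (0 : ℝ)))

/-- With probability `p` use the scheme `R`, with probability `1 - p` use the scheme `S`. -/
noncomputable def mix {k : ℕ} (p : unitInterval) (R S : RoundingScheme k) :
    RoundingScheme k where
  Ω := R.Ω ⊕ S.Ω
  P := ENNReal.ofReal (p : ℝ) • R.P.map Sum.inl + ENNReal.ofReal (1 - (p : ℝ)) • S.P.map Sum.inr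
  isProb := by
    refine ⟨?_⟩
    rw [Measure.add_apply, Measure.smul_apply, Measure.smul_apply,
      Measure.map_apply measurable_inl MeasurableSet.univ,
      Measure.map_apply measurable_inr MeasurableSet.univ]
    simp only [Set.preimage_univ, measure_univ, smul_eq_mul, mul_one]
    rw [← ENNReal.ofReal_add p.2.1 (by linarith [p.2.2])]
    simp
  label := Sum.elim R.label S.label
  measurable_label := fun x => by
    exact measurable_fun_sum (R.measurable_label x) (S.measurable_label x)

end RoundingScheme

/-! ## The two rounding schemes -/

open Classical in
/-- The smallest index with the property `q`. -/
noncomputable def firstIndex {k : ℕ} (q : Fin k → Prop) (h : ∃ i, q i) : Fin k :=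
  (Finset.univ.filter q).min' (by simpa [Finset.filter_nonempty_iff] using h)

theorem firstIndex_eq_iff {k : ℕ} (q : Fin k → Prop) (h : ∃ i, q i) (i : Fin k) :
    firstIndex q h = i ↔ q i ∧ ∀ j, j < i → ¬ q j := by
  classical
  have hmem : q (firstIndex q h) := by
    have := Finset.min'_mem (Finset.univ.filter q)
      (by simpa [Finset.filter_nonempty_iff] using h)
    unfold firstIndex
    convert (Finset.mem_filter.1 this).2
  have hle : ∀ j, q j → firstIndex q h ≤ j := by
    intro j hj
    unfold firstIndex
    exact Finset.min'_le _ _ (by simpa using hj)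
  constructor
  · rintro rfl
    exact ⟨hmem, fun j hj hq => absurd (hle j hq) (not_le.2 hj)⟩
  · rintro ⟨h1, h2⟩
    exact le_antisymm (hle i h1) (not_lt.1 fun hlt => h2 _ hlt hmem)

theorem measurable_firstIndex {Ω : Type*} [MeasurableSpace Ω] {k : ℕ} (q : Ω → Fin k → Prop)
    (h : ∀ ω, ∃ i, q ω i) (hq : ∀ i, MeasurableSet {ω | q ω i}) :
    Measurable fun ω => firstIndex (q ω) (h ω) := by
  refine measurable_to_countable' fun i => ?_
  have : (fun ω => firstIndex (q ω) (h ω)) ⁻¹' {i} =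
      {ω | q ω i} ∩ ⋂ j, ⋂ (_ : j < i), {ω | q ω j}ᶜ := by
    ext ω
    simp [firstIndex_eq_iff]
  rw [this]
  exact (hq i).inter (MeasurableSet.iInter fun j => MeasurableSet.iInter fun _ => (hq j).compl)

theorem simplex_nonempty_index {k : ℕ} (x : Simplex k) : Nonempty (Fin k) := by
  by_contra h
  rw [not_nonempty_iff] at h
  have := x.2.2
  simp at this

/-- The value `Z_i / x_i ∈ [0, ∞]` for `Z_i > 0`, with `Z_i / 0 = ∞`. -/
noncomputable def clockTime {k : ℕ} (z : Fin k → ℝ) (x : Simplex k) (i : Fin k) : ℝ≥0∞ :=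
  ENNReal.ofReal (z i) / ENNReal.ofReal ((x : Fin k → ℝ) i)

theorem exists_clockTime_min {k : ℕ} (z : Fin k → ℝ) (x : Simplex k) :
    ∃ i, ∀ j, clockTime z x i ≤ clockTime z x j := by
  have := simplex_nonempty_index x
  exact Finite.exists_min (clockTime z x)

/-- Exponential Clocks: `Z_1, …, Z_k` are independent exponential variables, and `x` is
labeled by `argmin_i Z_i / x_i` (ties have probability zero and go to the smallest index). -/
noncomputable def exponentialClocks (k : ℕ) : RoundingScheme k where
  Ω := Fin k → ℝ
  P := Measure.pi fun _ => ProbabilityTheory.expMeasure 1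
  isProb := by
    have := ProbabilityTheory.isProbabilityMeasure_expMeasure (zero_lt_one' ℝ)
    infer_instance
  label := fun z x =>
    firstIndex (fun i => ∀ j, clockTime z x i ≤ clockTime z x j) (exists_clockTime_min z x)
  measurable_label := fun x => by
    refine measurable_firstIndex _ _ fun i => ?_
    have hm : ∀ i, Measurable fun z : Fin k → ℝ => clockTime z x i := fun i =>
      ((ENNReal.measurable_ofReal.comp (measurable_pi_apply i)).div_const _)
    simp only [Set.ofPred_forall]
    exact MeasurableSet.iInter fun j => measurableSet_le (hm i) (hm j)

instance permMeasurableSpace (k : ℕ) : MeasurableSpace (Equiv.Perm (Fin k)) := ⊤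

instance permMeasurableSingletonClass (k : ℕ) :
    MeasurableSingletonClass (Equiv.Perm (Fin k)) := ⟨fun _ => trivial⟩

theorem exists_threshold_pos {k : ℕ} (θ : ℝ) (σ : Equiv.Perm (Fin k)) (x : Simplex k) :
    ∃ n : Fin k, θ ≤ (x : Fin k → ℝ) (σ n) ∨ (n : ℕ) + 1 = k := by
  obtain ⟨i⟩ := simplex_nonempty_index x
  have hk : 0 < k := lt_of_le_of_lt (Nat.zero_le _) i.2
  exact ⟨⟨k - 1, by omega⟩, Or.inr (by simp; omega)⟩

/-- The partition of Single Threshold for the threshold `θ` and the order `σ` of the terminals: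
`x` goes to the first terminal `σ(n)` among `σ(1), …, σ(k-1)` with `x_{σ(n)} ≥ θ`, and to the
last terminal `σ(k)` if there is none. -/
noncomputable def thresholdLabel {k : ℕ} (θ : ℝ) (σ : Equiv.Perm (Fin k)) (x : Simplex k) :
    Fin k :=
  σ (firstIndex (fun n => θ ≤ (x : Fin k → ℝ) (σ n) ∨ (n : ℕ) + 1 = k)
    (exists_threshold_pos θ σ x))

/-- Single Threshold: the threshold `θ ∈ (0,1]` has the distribution `μ`, and `σ` is an
independent uniformly random permutation of the terminals. -/
noncomputable def singleThreshold (k : ℕ) (μ : Measure (Set.Ioc (0 : ℝ) 1))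
    [IsProbabilityMeasure μ] : RoundingScheme k where
  Ω := Set.Ioc (0 : ℝ) 1 × Equiv.Perm (Fin k)
  P := μ.prod (PMF.uniformOfFintype (Equiv.Perm (Fin k))).toMeasure
  isProb := inferInstance
  label := fun ω x => thresholdLabel (ω.1 : ℝ) ω.2 x
  measurable_label := fun x => by
    refine measurable_from_prod_countable_left fun σ => ?_
    have h := measurable_firstIndex (Ω := Set.Ioc (0 : ℝ) 1) _
      (fun θ => exists_threshold_pos (θ : ℝ) σ x) fun n =>
        (measurableSet_le measurable_subtype_coe measurable_const).union
          (MeasurableSet.const ((n : ℕ) + 1 = k))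
    exact (measurable_of_finite (σ : Fin k → Fin k)).comp h

/-- The combination: Exponential Clocks with probability `p`, and with probability `1 - p`
Single Threshold with threshold distribution `μ`. -/
noncomputable def combination (k : ℕ) (p : unitInterval) (μ : Measure (Set.Ioc (0 : ℝ) 1))
    [IsProbabilityMeasure μ] : RoundingScheme k :=
  RoundingScheme.mix p (exponentialClocks k) (singleThreshold k μ)

/-! ## Multiway Cut and the approximation factor of a rounding scheme -/

/-- An instance of Multiway Cut with `k` terminals: a finite weighted graph (each undirected
edge is listed as a pair `(v, v')`) with `k` distinct terminals. -/
structure MultiwayCut (k : ℕ) where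
  V : Type
  [finiteV : Finite V]
  E : Finset (V × V)
  weight : V × V → ℝ≥0
  terminal : Fin k ↪ V

namespace MultiwayCut

/-- The feasible solutions of the CKR relaxation: an embedding of the vertices in the simplex
that puts each terminal at its vertex of the simplex. -/
def IsFractionalSolution {k : ℕ} (I : MultiwayCut k) (x : I.V → Simplex k) : Prop :=
  ∀ t, (x (I.terminal t) : Fin k → ℝ) = Pi.single t 1

/-- The objective `∑_{(v,v') ∈ E} w_{v,v'} · ½ ‖x_v - x_{v'}‖₁` of the CKR relaxation. -/
noncomputable def objective {k : ℕ} (I : MultiwayCut k) (x : I.V → Simplex k) : ℝ≥0∞ :=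
  ∑ e ∈ I.E, (I.weight e : ℝ≥0∞) * ENNReal.ofReal (edgeLength (x e.1 : Fin k → ℝ) (x e.2))

/-- The total weight of the edges that the assignment `a` of vertices to terminals cuts. -/
noncomputable def cutWeight {k : ℕ} (I : MultiwayCut k) (a : I.V → Fin k) : ℝ≥0∞ :=
  ∑ e ∈ I.E, if a e.1 ≠ a e.2 then (I.weight e : ℝ≥0∞) else 0

end MultiwayCut

/-- The scheme provides an approximation factor `α` for Multiway Cut with `k` terminals:
rounding any fractional solution costs in expectation at most `α` times its objective. -/
def RoundingScheme.AchievesFactor {k : ℕ} (R : RoundingScheme k) (α : ℝ≥0) : Prop :=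
  ∀ (I : MultiwayCut k) (x : I.V → Simplex k), I.IsFractionalSolution x →
    ∫⁻ ω, I.cutWeight (fun v => R.label ω (x v)) ∂(R.P) ≤ (α : ℝ≥0∞) * I.objective x

/-! ## The game: the payoff, and the mixed strategy of the adversary -/

/-- The expected payment to an adversary who draws an edge of the simplex from `A`: the
algorithm pays `1 / length` if the edge is cut, and nothing otherwise. -/
noncomputable def expectedPayoff {k : ℕ} (R : RoundingScheme k)
    (A : Measure (Simplex k × Simplex k)) : ℝ≥0∞ :=
  ∫⁻ e, R.cutProb e.1 e.2 / ENNReal.ofReal (edgeLength (e.1 : Fin k → ℝ) e.2) ∂A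

namespace Adversary

/-- The parameter `b = √5 - 2`. -/
noncomputable def b : ℝ := √5 - 2

/-- The edge length `ε = (1 - 2b) / (k - 2)`. -/
noncomputable def ε (k : ℕ) : ℝ := (1 - 2 * b) / ((k : ℝ) - 2)

/-- The edge `(v, v')` with `v_i = s`, `v_j = t`, `v_l = (1 - s - t) / (k - 2)` for `l ≠ i, j`,
and `v' = v - ε 1_i + ε 1_j`. -/
noncomputable def edge (k : ℕ) (i j : Fin k) (s t : ℝ) : (Fin k → ℝ) × (Fin k → ℝ) :=
  let v : Fin k → ℝ := fun l => if l = i then s else if l = j then t else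
    (1 - s - t) / ((k : ℝ) - 2)
  (v, v - Pi.single i (ε k) + Pi.single j (ε k))

/-- A uniformly random edge of `A_{ij}`: `u_i ∈ [3b, 1]`, `u_j = 0`. -/
noncomputable def uniformA (k : ℕ) (i j : Fin k) : Measure ((Fin k → ℝ) × (Fin k → ℝ)) :=
  (ProbabilityTheory.cond volume (Set.Icc (3 * b) 1)).map fun s => edge k i j s 0

/-- A uniformly random edge of `B_{ij}`: `u_i + 2 u_j = 3b`, `u_j ∈ [0, b]`. -/
noncomputable def uniformB (k : ℕ) (i j : Fin k) : Measure ((Fin k → ℝ) × (Fin k → ℝ)) :=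
  (ProbabilityTheory.cond volume (Set.Icc 0 b)).map fun t => edge k i j (3 * b - 2 * t) t

/-- The single edge of `C_{ij}`: `u_i = 1`, `u_j = 0`. -/
noncomputable def diracC (k : ℕ) (i j : Fin k) : Measure ((Fin k → ℝ) × (Fin k → ℝ)) :=
  Measure.dirac (edge k i j 1 0)

/-- The total masses of the edge sets `A`, `B`, `C` (they add up to `1`). -/
noncomputable def massA (k : ℕ) : ℝ := (1 - 3 * b) / (1 - b) * (1 - 1 / ((k : ℝ) - 2))

noncomputable def massB (k : ℕ) : ℝ := 2 * b / (1 - b) - 1 / ((k : ℝ) - 2)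

noncomputable def massC (k : ℕ) : ℝ := 2 * (1 - 2 * b) / ((1 - b) * ((k : ℝ) - 2))

/-- The distribution of the adversary's edge, as a measure on pairs of vectors: the masses are
spread evenly over the `k (k - 1)` ordered pairs of terminals. -/
noncomputable def vectorDistribution (k : ℕ) : Measure ((Fin k → ℝ) × (Fin k → ℝ)) :=
  ∑ ij ∈ (Finset.univ : Finset (Fin k)).offDiag, ENNReal.ofReal (1 / ((k : ℝ) * ((k : ℝ) - 1))) •
    (ENNReal.ofReal (massA k) • uniformA k ij.1 ij.2 +
      ENNReal.ofReal (massB k) • uniformB k ij.1 ij.2 +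
      ENNReal.ofReal (massC k) • diracC k ij.1 ij.2)

/-- The same distribution as a measure on the edges of the simplex (that it is a probability
measure says that no mass lies outside the simplex). -/
noncomputable def strategy (k : ℕ) : Measure (Simplex k × Simplex k) :=
  (vectorDistribution k).comap (Prod.map Subtype.val Subtype.val)

end Adversary

/-!
The adversary plays the random edge `strategy k`, and the claim is that every combination is cut
with expected payoff at least `1 / (1 - b) - O(1 / k)`, where `1 / (1 - b) = (3 + √5) / 4`. As the
cut probability of a combination is a convex combination, it is enough to see this for
Exponential Clocks and for Single Threshold with a deterministic threshold `θ`; and as all the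
schemes treat the terminals alike, for one ordered pair `(i, j)` (`pairAverage`).

*Exponential Clocks.* With `w = max(x, y)`, a label `m ≠ i, j` is shared by `x` and `y` only if
the clock `Z_m / w_m` comes first among all `Z_l / w_l`, and for `m = i`, `m = j` the same holds
with `w = y`, `w = x`. The first clock is `m` with probability `w_m / ∑ w`
(`pi_expMeasure_clock_first`). Summing over `m` shows that an edge of type `(i, j)` and length `d`
is cut with probability at least `d (1 + r / (1 + d))`, where `r = 1 - x_i - x_j`
(`exponentialClocks_cutProb_ge`). The payoff is about `2 - u_i - u_j`, whose average over `A` and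
`B` is `1 / (1 - b)`, because `b² + 4 b = 1`.

*Single Threshold.* For an edge of the adversary, the coordinates other than `i`, `j` are at most
`ε`. If `i` alone reaches the threshold at `v`, and no longer does at `v'`, the edge is cut unless
`i` is last in the random order (`thresholdCutProb_ge_of_leave`). If `j` reaches the threshold
only at `v'`, where `i` is the only possible competitor, the edge is cut when `j` precedes `i`, so
with probability at least `1 / 2` (`thresholdCutProb_ge_of_enter`). The distribution balances the
two: for `θ ≤ ε` the edge `C` enters the threshold set of `j`; for `ε < θ ≤ b` the edges of `B` with
`u_j ∈ [θ - ε, θ)` do; for `b < θ ≤ 1 - ε` the edges of `A` and `B` with `u_i ∈ [θ, θ + ε)` leave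
the threshold set of `i`; and for `θ > 1 - ε` the edge `C` does. Each time the payoff is at least
`1 / (1 - b)` up to a relative error of order `1 / k` (`securedPayoff_le_singleThreshold`).

Conversely, a scheme with the approximation factor `α` cuts each edge of the simplex with
probability at most `α` times its length, as is seen from graphs with one edge. If instead all cut
densities are at most `α`, the same holds for each edge of type `(i, j)`, by subdividing it into
short edges (`le_mul_of_locally_le`). In both cases the expected payoff is at most `α`.
-/

/-! ### Exponential clocks -/

theorem expMeasure_one_Ici {c : ℝ} (hc : 0 ≤ c) :
    ProbabilityTheory.expMeasure 1 (Set.Ici c) = ENNReal.ofReal (Real.exp (-c)) := by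
  have := ProbabilityTheory.isProbabilityMeasure_expMeasure (zero_lt_one' ℝ)
  have hac : ProbabilityTheory.expMeasure 1 ≪ volume := withDensity_absolutelyContinuous _ _
  have h0 : ProbabilityTheory.expMeasure 1 {c} = 0 := hac (by simp)
  have h1 : ProbabilityTheory.expMeasure 1 (Set.Iic c) = ENNReal.ofReal (1 - Real.exp (-c)) := by
    rw [← ProbabilityTheory.ofReal_cdf, ProbabilityTheory.cdf_expMeasure_eq one_pos, if_pos hc,
      one_mul]
  have h2 : ProbabilityTheory.expMeasure 1 (Set.Ioi c) = ENNReal.ofReal (Real.exp (-c)) := by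
    rw [← Set.compl_Iic, prob_compl_eq_one_sub measurableSet_Iic, h1, ← ENNReal.ofReal_one,
      ← ENNReal.ofReal_sub _ (by simpa using hc)]
    congr 1; ring
  rw [← h2, ← Set.Ioi_union_left]
  refine le_antisymm ((measure_union_le _ _).trans (by rw [h0, add_zero])) (measure_mono
    Set.subset_union_left)

theorem ae_pos_expMeasure_one : ∀ᵐ z ∂(ProbabilityTheory.expMeasure 1), 0 < z := by
  have := ProbabilityTheory.isProbabilityMeasure_expMeasure (zero_lt_one' ℝ)
  rw [ae_iff]
  have : {a : ℝ | ¬ 0 < a} = Set.Iic 0 := by ext; simp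
  rw [this, ← ProbabilityTheory.ofReal_cdf, ProbabilityTheory.cdf_expMeasure_eq one_pos]
  simp

theorem lintegral_exp_neg_mul_expMeasure_one {c : ℝ} (hc : 0 ≤ c) :
    ∫⁻ z, ENNReal.ofReal (Real.exp (-(c * z))) ∂(ProbabilityTheory.expMeasure 1) =
      ENNReal.ofReal (1 / (1 + c)) := by
  have hc1 : 0 < 1 + c := by linarith
  have hd : ProbabilityTheory.expMeasure 1 =
      volume.withDensity (ProbabilityTheory.exponentialPDF 1) := rfl
  have hm : ∀ r, Measurable (ProbabilityTheory.exponentialPDF r) := fun r =>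
    (ProbabilityTheory.measurable_exponentialPDFReal r).ennreal_ofReal
  rw [hd, lintegral_withDensity_eq_lintegral_mul _ (hm 1) (by fun_prop)]
  have : ∀ z, (ProbabilityTheory.exponentialPDF 1 *
      fun z => ENNReal.ofReal (Real.exp (-(c * z)))) z =
      ENNReal.ofReal (1 / (1 + c)) * ProbabilityTheory.exponentialPDF (1 + c) z := by
    intro z
    simp only [Pi.mul_apply, ProbabilityTheory.exponentialPDF_eq]
    rw [← ENNReal.ofReal_mul (by split_ifs <;> positivity), ← ENNReal.ofReal_mul (by positivity)]
    congr 1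
    split_ifs
    · rw [one_mul, ← Real.exp_add, ← mul_assoc, one_div_mul_cancel hc1.ne', one_mul]
      ring_nf
    · simp
  simp_rw [this]
  rw [lintegral_const_mul _ (hm _), ProbabilityTheory.lintegral_exponentialPDF_eq_one hc1, mul_one]

/-- The race of exponential clocks: the clock `Z_m / w_m` comes first with probability
`w_m / ∑ w`. -/
theorem pi_expMeasure_clock_first {k : ℕ} (w : Fin k → ℝ) (hw : ∀ l, 0 ≤ w l) (m : Fin k)
    (hm : 0 < w m) :
    (Measure.pi fun _ : Fin k => ProbabilityTheory.expMeasure 1)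
      {z | ∀ l, z m * w l ≤ z l * w m} = ENNReal.ofReal (w m / ∑ l, w l) := by
  have := ProbabilityTheory.isProbabilityMeasure_expMeasure (zero_lt_one' ℝ)
  obtain _ | n := k
  · exact m.elim0
  have hmp := measurePreserving_piFinSuccAbove
    (fun _ : Fin (n + 1) => ProbabilityTheory.expMeasure 1) m
  let S : Set (ℝ × (Fin n → ℝ)) := {p | ∀ l, p.1 * (w (m.succAbove l) / w m) ≤ p.2 l}
  have hS : MeasurableSet S := by
    simp only [S, Set.ofPred_forall]
    exact MeasurableSet.iInter fun l => measurableSet_le (by fun_prop) (by fun_prop)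
  have hpre : {z : Fin (n + 1) → ℝ | ∀ l, z m * w l ≤ z l * w m} =
      MeasurableEquiv.piFinSuccAbove (fun _ => ℝ) m ⁻¹' S := by
    ext z
    simp only [Set.mem_ofPred_eq, Set.mem_preimage, S, Fin.forall_iff_succAbove m]
    simp [MeasurableEquiv.piFinSuccAbove, Fin.insertNthEquiv, Fin.removeNth, ← mul_div_assoc,
      div_le_iff₀ hm]
  rw [hpre, hmp.measure_preimage hS.nullMeasurableSet, Measure.prod_apply hS]
  have hfib : ∀ᵐ z ∂(ProbabilityTheory.expMeasure 1),
      (Measure.pi fun _ : Fin n => ProbabilityTheory.expMeasure 1) (Prod.mk z ⁻¹' S) =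
        ENNReal.ofReal (Real.exp (-((∑ l, w (m.succAbove l) / w m) * z))) := by
    filter_upwards [ae_pos_expMeasure_one] with z hz
    have : Prod.mk z ⁻¹' S = Set.univ.pi fun l => Set.Ici (z * (w (m.succAbove l) / w m)) := by
      ext y; simp [S, Pi.le_def]
    rw [this, Measure.pi_pi]
    have h0 : ∀ l, 0 ≤ z * (w (m.succAbove l) / w m) := fun l =>
      mul_nonneg hz.le (div_nonneg (hw _) hm.le)
    simp_rw [expMeasure_one_Ici (h0 _)]
    rw [← ENNReal.ofReal_prod_of_nonneg fun _ _ => (Real.exp_pos _).le, ← Real.exp_sum,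
      Finset.sum_neg_distrib, ← Finset.mul_sum, mul_comm z]
  rw [lintegral_congr_ae hfib, lintegral_exp_neg_mul_expMeasure_one
    (Finset.sum_nonneg fun l _ => div_nonneg (hw _) hm.le), Fin.sum_univ_succAbove w m,
    ← Finset.sum_div]
  congr 1
  field_simp

theorem ae_forall_pos_pi_expMeasure (k : ℕ) :
    ∀ᵐ z ∂(Measure.pi fun _ : Fin k => ProbabilityTheory.expMeasure 1), ∀ l, 0 < z l := by
  have := ProbabilityTheory.isProbabilityMeasure_expMeasure (zero_lt_one' ℝ)
  rw [eventually_all]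
  intro l
  exact (Measure.quasiMeasurePreserving_eval _ l).ae ae_pos_expMeasure_one

theorem exponentialClocks_label_le {k : ℕ} {z : Fin k → ℝ} {x : Simplex k} {m : Fin k}
    (h : (exponentialClocks k).label z x = m) (j : Fin k) :
    clockTime z x m ≤ clockTime z x j := by
  subst h
  exact ((firstIndex_eq_iff _ (exists_clockTime_min z x) _).1 rfl).1 j

theorem exists_simplex_pos {k : ℕ} (x : Simplex k) : ∃ j, 0 < x j := by
  by_contra! h
  have := Finset.sum_nonpos fun j (_ : j ∈ Finset.univ) => h j
  linarith [stdSimplex.sum_eq_one x]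

/-- A terminal whose coordinate vanishes does not win the race. -/
theorem coord_pos_of_exponentialClocks_label {k : ℕ} {z : Fin k → ℝ} (hz : ∀ l, 0 < z l)
    {x : Simplex k} {m : Fin k} (h : (exponentialClocks k).label z x = m) :
    0 < x m := by
  obtain ⟨j, hj⟩ := exists_simplex_pos x
  by_contra hm
  have hle := exponentialClocks_label_le h j
  have h1 : clockTime z x m = ∞ := by
    rw [clockTime, ENNReal.ofReal_of_nonpos (not_lt.1 hm), ENNReal.div_zero]
    simpa using hz m
  have h2 : clockTime z x j ≠ ∞ := ENNReal.div_ne_top ENNReal.ofReal_ne_top (by simpa using hj)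
  exact h2 (top_le_iff.1 (h1 ▸ hle))

theorem mul_le_mul_of_exponentialClocks_label {k : ℕ} {z : Fin k → ℝ} (hz : ∀ l, 0 < z l)
    {x : Simplex k} {m : Fin k} (h : (exponentialClocks k).label z x = m) (j : Fin k) :
    z m * x j ≤ z j * x m := by
  have hm := coord_pos_of_exponentialClocks_label hz h
  obtain hj | hj := (stdSimplex.zero_le x j).eq_or_lt
  · rw [← hj, mul_zero]
    exact mul_nonneg (hz j).le hm.le
  · have hle := exponentialClocks_label_le h j
    rw [clockTime, clockTime, ← ENNReal.ofReal_div_of_pos hm, ← ENNReal.ofReal_div_of_pos hj,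
      ENNReal.ofReal_le_ofReal_iff (div_nonneg (hz j).le hj.le), div_le_div_iff₀ hm hj] at hle
    exact hle

/-- If `w` agrees with `x` or with `y` at `m` and `l`, for each `l`, then both points get the label
`m` with probability at most `w_m / ∑ w`: the label forces the clock `Z_m / w_m` to come first. -/
theorem exponentialClocks_both_label_le {k : ℕ} (x y : Simplex k) (w : Fin k → ℝ)
    (hw : ∀ l, 0 ≤ w l) (m : Fin k)
    (h : ∀ l, (x m = w m ∧ x l = w l) ∨
      (y m = w m ∧ y l = w l)) :
    (exponentialClocks k).P {z | (exponentialClocks k).label z x = m ∧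
      (exponentialClocks k).label z y = m} ≤ ENNReal.ofReal (w m / ∑ l, w l) := by
  have hP : (exponentialClocks k).P = Measure.pi fun _ => ProbabilityTheory.expMeasure 1 := rfl
  have hae := ae_forall_pos_pi_expMeasure k
  rw [← hP] at hae
  obtain hm | hm := (hw m).eq_or_lt
  · refine le_of_eq_of_le ?_ zero_le
    rw [measure_eq_zero_iff_ae_notMem]
    filter_upwards [hae] with z hz hzm
    obtain ⟨h1, -⟩ | ⟨h1, -⟩ := h m
    · exact (coord_pos_of_exponentialClocks_label hz hzm.1).ne' (h1.trans hm.symm)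
    · exact (coord_pos_of_exponentialClocks_label hz hzm.2).ne' (h1.trans hm.symm)
  · rw [← pi_expMeasure_clock_first w hw m hm, ← hP]
    refine measure_mono_ae ?_
    filter_upwards [hae] with z hz hzm l
    obtain ⟨h1, h2⟩ | ⟨h1, h2⟩ := h l
    · rw [← h1, ← h2]
      exact mul_le_mul_of_exponentialClocks_label hz hzm.1 l
    · rw [← h1, ← h2]
      exact mul_le_mul_of_exponentialClocks_label hz hzm.2 l

/-- Moving `d` units from `i` to `j`, Exponential Clocks cuts the edge with probability at
least `d (1 + r / (1 + d))`, where `r = 1 - x_i - x_j`. The labels shared by `x` and `y` have total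
probability at most `y_i + x_j + r / (1 + d)`. -/
theorem exponentialClocks_cutProb_ge {k : ℕ} {i j : Fin k} (hij : i ≠ j) {d : ℝ} (hd : 0 ≤ d)
    (x y : Simplex k)
    (hxy : (y : Fin k → ℝ) = (x : Fin k → ℝ) - Pi.single i d + Pi.single j d) :
    ENNReal.ofReal (d * (1 + (1 - x i - x j) / (1 + d))) ≤
      (exponentialClocks k).cutProb x y := by
  set R := exponentialClocks k
  have hyi : y i = x i - d := by
    rw [hxy]; simp [hij]
  have hyj : y j = x j + d := by
    rw [hxy]; simp [hij.symm]
  have hyl : ∀ l, l ≠ i → l ≠ j → y l = x l := by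
    intro l h1 h2; rw [hxy]; simp [h1, h2]
  -- the pointwise maximum of `x` and `y`
  let w : Fin k → ℝ := (x : Fin k → ℝ) + Pi.single j d
  have hw : ∀ l, 0 ≤ w l := fun l => by
    have : 0 ≤ (Pi.single j d : Fin k → ℝ) l := by
      by_cases h : l = j
      · subst h; simpa
      · simp [h]
    exact add_nonneg (x.2.1 l) this
  have hws : ∑ l, w l = 1 + d := by
    simp [w, Finset.sum_add_distrib, stdSimplex.sum_eq_one x]
  let u : Fin k → ℝ := fun m => if m = i then y i else
    if m = j then x j else x m / (1 + d)
  have hu : ∀ m, R.P {z | R.label z x = m ∧ R.label z y = m} ≤ ENNReal.ofReal (u m) := by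
    intro m
    by_cases hmi : m = i
    · subst hmi
      have := exponentialClocks_both_label_le x y y y.2.1 m (by simp)
      simpa [u, stdSimplex.sum_eq_one y] using this
    by_cases hmj : m = j
    · subst hmj
      have := exponentialClocks_both_label_le x y x x.2.1 m (by simp)
      simpa [u, hmi, stdSimplex.sum_eq_one x] using this
    · have := exponentialClocks_both_label_le x y w hw m (fun l => by
        by_cases hlj : l = j
        · subst hlj
          right; simp [w, hmj, hyl m hmi hmj, hyj]
        · left; simp [w, hmj, hlj])
      rw [hws] at this
      simpa [u, hmi, hmj, w] using this
  have hu0 : ∀ m, 0 ≤ u m := by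
    intro m
    have := x.2.1 m; have := x.2.1 j; have := y.2.1 i
    simp only [u]; split_ifs
    · assumption
    · assumption
    · positivity
  have hcover : (1 : ℝ≥0∞) ≤ R.cutProb x y + ENNReal.ofReal (∑ m, u m) := by
    rw [ENNReal.ofReal_sum_of_nonneg fun m _ => hu0 m, ← measure_univ (μ := R.P)]
    refine le_trans (measure_mono ?_) ((measure_union_le {z | R.label z x ≠ R.label z y}
      (⋃ m, {z | R.label z x = m ∧ R.label z y = m})).trans (add_le_add le_rfl
        ((measure_iUnion_fintype_le _ _).trans (Finset.sum_le_sum fun m _ => hu m))))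
    intro z _
    by_cases h : R.label z x = R.label z y
    · exact Or.inr (Set.mem_iUnion.2 ⟨R.label z x, rfl, h.symm⟩)
    · exact Or.inl h
  have hsum : ∑ m, u m = y i + x j +
      (1 - x i - x j) / (1 + d) := by
    have h1 : ∀ m, u m = x m / (1 + d) +
        (if m = i then y i - x i / (1 + d) else 0) +
        (if m = j then x j - x j / (1 + d) else 0) := by
      intro m
      simp only [u]
      by_cases hmi : m = i
      · subst hmi; simp [hij]
      · by_cases hmj : m = j
        · subst hmj; simp [hmi]
        · simp [hmi, hmj]
    simp_rw [h1]
    rw [Finset.sum_add_distrib, Finset.sum_add_distrib, ← Finset.sum_div, stdSimplex.sum_eq_one x]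
    simp
    ring
  have hreal : d * (1 + (1 - x i - x j) / (1 + d)) =
      1 - ∑ m, u m := by
    rw [hsum, hyi]; field_simp; ring
  rw [hreal, ENNReal.ofReal_sub _ (Finset.sum_nonneg fun m _ => hu0 m), ENNReal.ofReal_one]
  exact tsub_le_iff_right.2 hcover

/-! ### Single Threshold for a fixed threshold -/

/-- The uniform distribution on the orders of the terminals. -/
noncomputable abbrev uniformPerm (k : ℕ) : Measure (Equiv.Perm (Fin k)) :=
  (PMF.uniformOfFintype (Equiv.Perm (Fin k))).toMeasure

theorem uniformPerm_preimage_mul_left {k : ℕ} (τ : Equiv.Perm (Fin k))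
    (S : Set (Equiv.Perm (Fin k))) :
    uniformPerm k {σ | τ * σ ∈ S} = uniformPerm k S := by
  classical
  have hm : ∀ T : Set (Equiv.Perm (Fin k)), MeasurableSet T := fun _ => trivial
  rw [PMF.toMeasure_uniformOfFintype_apply _ (hm _), PMF.toMeasure_uniformOfFintype_apply _ (hm _)]
  congr 2
  exact Fintype.card_congr ((Equiv.mulLeft τ).subtypeEquiv fun σ => Iff.rfl)

theorem uniformPerm_symm_eq {k : ℕ} (n i j : Fin k) :
    uniformPerm k {σ | σ.symm i = n} = uniformPerm k {σ | σ.symm j = n} := by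
  rw [← uniformPerm_preimage_mul_left (Equiv.swap i j) {σ | σ.symm i = n}]
  congr 1
  ext σ
  simp [Equiv.Perm.mul_def]

theorem uniformPerm_symm_eq_le {k : ℕ} (n i : Fin k) :
    uniformPerm k {σ | σ.symm i = n} ≤ ENNReal.ofReal (1 / k) := by
  have hk : (0 : ℝ) < k := by exact_mod_cast i.pos
  have h := sum_measure_le_measure_univ (μ := uniformPerm k) (s := Finset.univ)
    (t := fun j => {σ | σ.symm j = n}) (fun j _ => MeasurableSet.nullMeasurableSet trivial)
    (fun j _ l _ hjl => (Set.disjoint_left.2 fun σ hj hl => hjl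
      (σ.symm.injective (hj.trans hl.symm))).aedisjoint)
  simp_rw [fun j => uniformPerm_symm_eq n j i] at h
  rw [measure_univ, Finset.sum_const, Finset.card_univ, Fintype.card_fin, nsmul_eq_mul] at h
  rw [one_div, ENNReal.ofReal_inv_of_pos hk, ENNReal.ofReal_natCast,
    ENNReal.le_inv_iff_mul_le, mul_comm]
  exact h

theorem half_le_uniformPerm_lt {k : ℕ} {i j : Fin k} (hij : i ≠ j) :
    ENNReal.ofReal (1 / 2) ≤ uniformPerm k {σ | σ.symm i < σ.symm j} := by
  have hs : uniformPerm k {σ | σ.symm i < σ.symm j} = uniformPerm k {σ | σ.symm j < σ.symm i} := by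
    rw [← uniformPerm_preimage_mul_left (Equiv.swap i j) {σ | σ.symm i < σ.symm j}]
    congr 1
    ext σ
    simp [Equiv.Perm.mul_def]
  have h : 1 ≤ uniformPerm k {σ | σ.symm i < σ.symm j} +
      uniformPerm k {σ | σ.symm i < σ.symm j} := by
    nth_rewrite 2 [hs]
    rw [← measure_univ (μ := uniformPerm k)]
    refine le_trans (measure_mono fun σ _ => ?_) (measure_union_le _ _)
    exact lt_or_gt_of_ne fun h => hij (σ.symm.injective h)
  rw [one_div, ENNReal.ofReal_inv_of_pos two_pos, ENNReal.ofReal_ofNat]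
  rw [← two_mul] at h
  rw [ENNReal.inv_le_iff_le_mul (by simp) (by simp)]
  exact h

theorem thresholdLabel_eq_iff {k : ℕ} (θ : ℝ) (σ : Equiv.Perm (Fin k)) (x : Simplex k)
    (l : Fin k) :
    thresholdLabel θ σ x = l ↔ (θ ≤ x l ∨ (σ.symm l : ℕ) + 1 = k) ∧
      ∀ n < σ.symm l, x (σ n) < θ := by
  rw [thresholdLabel, ← Equiv.eq_symm_apply, firstIndex_eq_iff]
  simp only [Equiv.apply_symm_apply, not_or, not_le]
  refine and_congr_right fun _ => forall₂_congr fun n hn => and_iff_left ?_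
  have := (σ.symm l).2
  have : (n : ℕ) < σ.symm l := hn
  omega

/-- The probability, over the random order, that Single Threshold with threshold `θ` cuts the
edge `(x, y)`. -/
noncomputable def thresholdCutProb {k : ℕ} (θ : ℝ) (x y : Simplex k) : ℝ≥0∞ :=
  uniformPerm k {σ | thresholdLabel θ σ x ≠ thresholdLabel θ σ y}

/-- If only `i` reaches the threshold at `x`, and not at `y`, then the edge is cut unless `i` is
the last terminal. -/
theorem thresholdCutProb_ge_of_leave {k : ℕ} {θ : ℝ} {x y : Simplex k} {i : Fin k}
    (hxi : θ ≤ x i) (hyi : y i < θ) (hx : ∀ l, l ≠ i → x l < θ) :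
    ENNReal.ofReal (1 - 1 / k) ≤ thresholdCutProb θ x y := by
  have hk : 0 < k := i.pos
  have h1 : 1 ≤ thresholdCutProb θ x y + ENNReal.ofReal (1 / k) := by
    refine le_trans ?_ (add_le_add le_rfl (uniformPerm_symm_eq_le ⟨k - 1, by omega⟩ i))
    rw [← measure_univ (μ := uniformPerm k)]
    refine le_trans (measure_mono fun σ _ => ?_) (measure_union_le _ _)
    by_cases hσ : σ.symm i = ⟨k - 1, by omega⟩
    · exact Or.inr hσ
    left
    have hx' : thresholdLabel θ σ x = i :=
      (thresholdLabel_eq_iff _ _ _ _).2 ⟨Or.inl hxi, fun n hn => hx _ fun h => by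
        rw [← h, Equiv.symm_apply_apply] at hn; exact hn.false⟩
    change thresholdLabel θ σ x ≠ thresholdLabel θ σ y
    rw [hx']
    intro hy
    rcases ((thresholdLabel_eq_iff _ _ _ _).1 hy.symm).1 with h | h
    · exact absurd h (not_le.2 hyi)
    · exact hσ (Fin.ext (by simp; omega))
  rw [ENNReal.ofReal_sub _ (by positivity), ENNReal.ofReal_one]
  exact tsub_le_iff_right.2 h1

/-- If `j` does not reach the threshold at `x`, and at `y` it does, with at most one
competitor `i`, then the edge is cut whenever `j` precedes `i`. -/
theorem thresholdCutProb_ge_of_enter {k : ℕ} {θ : ℝ} {x y : Simplex k} {i j : Fin k}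
    (hij : i ≠ j) (hxj : x j < θ) (hyj : θ ≤ y j) (hy : ∀ l, l ≠ i → l ≠ j → y l < θ) :
    ENNReal.ofReal (1 / 2) ≤ thresholdCutProb θ x y := by
  refine (half_le_uniformPerm_lt hij.symm).trans (measure_mono fun σ hσ => ?_)
  have hσ' : σ.symm j < σ.symm i := hσ
  have hy' : thresholdLabel θ σ y = j :=
    (thresholdLabel_eq_iff _ _ _ _).2 ⟨Or.inl hyj, fun n hn => hy _
      (fun h => by rw [← h, Equiv.symm_apply_apply] at hσ'; exact (hσ'.trans hn).false)
      (fun h => by rw [← h, Equiv.symm_apply_apply] at hn; exact hn.false)⟩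
  change thresholdLabel θ σ x ≠ thresholdLabel θ σ y
  rw [hy']
  intro hx
  rcases ((thresholdLabel_eq_iff _ _ _ _).1 hx).1 with h | h
  · exact absurd h (not_le.2 hxj)
  · have := (σ.symm i).2
    have : (σ.symm j : ℕ) < σ.symm i := hσ'
    omega

theorem RoundingScheme.measurableSet_cut {k : ℕ} (R : RoundingScheme k) (x y : Simplex k) :
    MeasurableSet {ω | R.label ω x ≠ R.label ω y} :=
  (measurableSet_eq_fun (R.measurable_label x) (R.measurable_label y)).compl

theorem singleThreshold_cutProb {k : ℕ} (μ : Measure (Set.Ioc (0 : ℝ) 1))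
    [IsProbabilityMeasure μ] (x y : Simplex k) :
    (singleThreshold k μ).cutProb x y = ∫⁻ θ, thresholdCutProb (θ : ℝ) x y ∂μ :=
  Measure.prod_apply ((singleThreshold k μ).measurableSet_cut x y)

theorem mix_cutProb {k : ℕ} (p : unitInterval) (R S : RoundingScheme k) (x y : Simplex k) :
    (RoundingScheme.mix p R S).cutProb x y =
      ENNReal.ofReal p * R.cutProb x y + ENNReal.ofReal (1 - p) * S.cutProb x y := by
  have key : ∀ T : Set (R.Ω ⊕ S.Ω), MeasurableSet T →
      (ENNReal.ofReal (p : ℝ) • R.P.map Sum.inl + ENNReal.ofReal (1 - (p : ℝ)) •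
        S.P.map Sum.inr : Measure (R.Ω ⊕ S.Ω)) T = ENNReal.ofReal p * R.P (Sum.inl ⁻¹' T) +
          ENNReal.ofReal (1 - p) * S.P (Sum.inr ⁻¹' T) := fun T hT => by
    rw [Measure.add_apply, Measure.smul_apply, Measure.smul_apply,
      Measure.map_apply measurable_inl hT, Measure.map_apply measurable_inr hT]
    rfl
  exact key _ ((RoundingScheme.mix p R S).measurableSet_cut x y)

/-! ### Averages over an interval -/

/-- A function that is at least `c` on a subinterval has at least `c` times the relative length of
the subinterval as its average. -/
theorem le_lintegral_cond_Icc {a b u v c : ℝ} (hab : a < b) (hc : 0 ≤ c)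
    (huv : Set.Ioo u v ⊆ Set.Icc a b) {h : ℝ → ℝ≥0∞}
    (hh : ∀ s ∈ Set.Ioo u v, ENNReal.ofReal c ≤ h s) :
    ENNReal.ofReal (c * ((v - u) / (b - a))) ≤
      ∫⁻ s, h s ∂(ProbabilityTheory.cond volume (Set.Icc a b)) := by
  have hab' : 0 < b - a := sub_pos.2 hab
  calc ENNReal.ofReal (c * ((v - u) / (b - a)))
      = ENNReal.ofReal c * ProbabilityTheory.cond volume (Set.Icc a b) (Set.Ioo u v) := by
        rw [ProbabilityTheory.cond_apply measurableSet_Icc, Set.inter_eq_right.2 huv,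
          Real.volume_Icc, Real.volume_Ioo, ENNReal.ofReal_mul hc, ENNReal.ofReal_div_of_pos hab',
          ENNReal.div_eq_inv_mul]
    _ = ∫⁻ s, (Set.Ioo u v).indicator (fun _ => ENNReal.ofReal c) s
          ∂(ProbabilityTheory.cond volume (Set.Icc a b)) := by
        rw [lintegral_indicator measurableSet_Ioo, setLIntegral_const]
    _ ≤ _ := lintegral_mono fun s => Set.indicator_le (fun s hs => hh s hs) s

theorem lintegral_cond_Icc_ofReal_affine {a b m n : ℝ} (hab : a < b)
    (hpos : ∀ s ∈ Set.Icc a b, 0 ≤ m * s + n) :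
    ∫⁻ s, ENNReal.ofReal (m * s + n) ∂(ProbabilityTheory.cond volume (Set.Icc a b)) =
      ENNReal.ofReal (m * ((a + b) / 2) + n) := by
  have hab' : 0 < b - a := sub_pos.2 hab
  have hint : ∫ s in Set.Icc a b, (m * s + n) = (b - a) * (m * ((a + b) / 2) + n) := by
    rw [integral_Icc_eq_integral_Ioc, ← intervalIntegral.integral_of_le hab.le,
      intervalIntegral.integral_add (Continuous.intervalIntegrable (by fun_prop) _ _)
        (Continuous.intervalIntegrable (by fun_prop) _ _),
      intervalIntegral.integral_const_mul, integral_id, intervalIntegral.integral_const]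
    simp only [smul_eq_mul]
    ring
  rw [ProbabilityTheory.cond, lintegral_smul_measure, ← ofReal_integral_eq_lintegral_ofReal
    (Continuous.integrableOn_Icc (by fun_prop))
    ((ae_restrict_iff' measurableSet_Icc).2 (ae_of_all _ hpos)), hint, Real.volume_Icc,
    ENNReal.ofReal_mul hab'.le, smul_eq_mul, ← mul_assoc, ENNReal.inv_mul_cancel (by simpa)
    ENNReal.ofReal_ne_top, one_mul]

namespace Adversary

/-! ### The constants of the adversary -/

theorem b_sq : b ^ 2 = 1 - 4 * b := by
  have : √5 ^ 2 = 5 := Real.sq_sqrt (by norm_num)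
  unfold b; linarith

theorem b_gt : 0.236 < b := by
  have : (2.236 : ℝ) < √5 := Real.lt_sqrt_of_sq_lt (by norm_num)
  unfold b; linarith

theorem b_lt : b < 0.237 := by
  have : √5 < (2.237 : ℝ) := (Real.sqrt_lt' (by norm_num)).2 (by norm_num)
  unfold b; linarith

theorem one_div_one_sub_b : 1 / (1 - b) = (3 + √5) / 4 := by
  have : √5 ^ 2 = 5 := Real.sq_sqrt (by norm_num)
  have h := b_lt
  rw [div_eq_div_iff (by linarith) (by norm_num)]
  unfold b; linarith

theorem three_le_cast_sub_two {k : ℕ} (hk : 5 ≤ k) : (3 : ℝ) ≤ (k : ℝ) - 2 := by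
  have : (5 : ℝ) ≤ k := by exact_mod_cast hk
  linarith

theorem ε_pos {k : ℕ} (hk : 5 ≤ k) : 0 < ε k := by
  have := three_le_cast_sub_two hk
  have := b_lt
  exact div_pos (by linarith) (by linarith)

theorem ε_lt {k : ℕ} (hk : 5 ≤ k) : ε k < 0.18 := by
  have := three_le_cast_sub_two hk
  have := b_gt
  rw [ε, div_lt_iff₀ (by linarith)]
  linarith

theorem ε_le {k : ℕ} (hk : 5 ≤ k) : ε k ≤ 1 / ((k : ℝ) - 2) := by
  have := three_le_cast_sub_two hk
  have := b_gt
  exact div_le_div_of_nonneg_right (by linarith) (by linarith)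

/-- The payoff that the adversary secures: `1 / (1 - b)` up to a relative error `O(1 / k)`. -/
noncomputable def securedPayoff (k : ℕ) : ℝ := (1 - 3 / ((k : ℝ) - 2)) / (1 - b)

theorem massA_ge {k : ℕ} (hk : 5 ≤ k) :
    (1 - 2 / ((k : ℝ) - 2)) * ((1 - 3 * b) / (1 - b)) ≤ massA k := by
  have h3 := three_le_cast_sub_two hk
  have h1 := b_lt
  rw [massA, mul_comm]
  refine mul_le_mul_of_nonneg_left ?_ (div_nonneg (by linarith) (by linarith))
  have : 1 / ((k : ℝ) - 2) ≤ 2 / ((k : ℝ) - 2) :=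
    div_le_div_of_nonneg_right (by norm_num) (by linarith)
  linarith

theorem massB_ge {k : ℕ} (hk : 5 ≤ k) :
    (1 - 2 / ((k : ℝ) - 2)) * (2 * b / (1 - b)) ≤ massB k := by
  have h3 := three_le_cast_sub_two hk
  have h1 := b_lt
  have h2 := b_gt
  have h4 : 1 / 2 ≤ 2 * b / (1 - b) := by
    rw [div_le_div_iff₀ (by norm_num) (by linarith)]; linarith
  have h5 : 0 < 1 / ((k : ℝ) - 2) := by
    have : 0 < (k : ℝ) - 2 := by linarith
    positivity
  have h6 : 2 / ((k : ℝ) - 2) = 2 * (1 / ((k : ℝ) - 2)) := by ring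
  rw [massB, h6]
  nlinarith

theorem massC_eq (k : ℕ) : massC k = 2 * ε k / (1 - b) := by
  rw [massC, ε, ← div_div]; ring

theorem one_sub_two_div_pos {k : ℕ} (hk : 5 ≤ k) : 0 < 1 - 2 / ((k : ℝ) - 2) := by
  have h3 := three_le_cast_sub_two hk
  rw [sub_pos, div_lt_one (by linarith)]
  linarith

theorem massA_nonneg {k : ℕ} (hk : 5 ≤ k) : 0 ≤ massA k := by
  have h1 := b_lt
  exact (mul_nonneg (one_sub_two_div_pos hk).le
    (div_nonneg (by linarith) (by linarith))).trans (massA_ge hk)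

theorem massB_nonneg {k : ℕ} (hk : 5 ≤ k) : 0 ≤ massB k := by
  have h1 := b_lt
  have h2 := b_gt
  exact (mul_nonneg (one_sub_two_div_pos hk).le
    (div_nonneg (by linarith) (by linarith))).trans (massB_ge hk)

theorem massC_nonneg {k : ℕ} (hk : 5 ≤ k) : 0 ≤ massC k := by
  have h1 := b_lt
  have := ε_pos hk
  rw [massC_eq]
  exact div_nonneg (by linarith) (by linarith)

theorem mass_sum {k : ℕ} (hk : 5 ≤ k) : massA k + massB k + massC k = 1 := by
  have h3 := three_le_cast_sub_two hk
  have h1 := b_lt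
  have h4 : (k : ℝ) - 2 ≠ 0 := by linarith
  have h5 : 1 - b ≠ 0 := by linarith
  rw [massA, massB, massC]
  field_simp
  ring

/-- The secured payoff absorbs a relative loss `2 / (k - 2)` in the masses of `A` and `B`, and a
relative loss `d` in the payoff. -/
theorem securedPayoff_le_of_loss {k : ℕ} (hk : 5 ≤ k) {d : ℝ} (hd : d ≤ 1 / ((k : ℝ) - 2)) :
    securedPayoff k ≤ (1 - 2 / ((k : ℝ) - 2)) * (1 - d) / (1 - b) := by
  have h3 := three_le_cast_sub_two hk
  have h1 := b_lt
  have h0 : 0 < 1 / ((k : ℝ) - 2) := by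
    have : 0 < (k : ℝ) - 2 := by linarith
    positivity
  refine div_le_div_of_nonneg_right ?_ (by linarith)
  have h2 : 2 / ((k : ℝ) - 2) = 2 * (1 / ((k : ℝ) - 2)) := by ring
  have h4 : 3 / ((k : ℝ) - 2) = 3 * (1 / ((k : ℝ) - 2)) := by ring
  have h5 := one_sub_two_div_pos hk
  rw [h2] at h5 ⊢
  rw [h4]
  nlinarith

/-- The constant `10` comes from `3 / (k - 2) ≤ 5 / k` for `k ≥ 5` and `1 / (1 - b) ≤ 2`. -/
theorem target_le_securedPayoff {k : ℕ} (hk : 5 ≤ k) :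
    (3 + √5) / 4 - 10 / k ≤ securedPayoff k := by
  have h3 := three_le_cast_sub_two hk
  have h1 := b_lt
  have hk0 : (0 : ℝ) < k := by linarith
  have h4 : 3 / ((k : ℝ) - 2) ≤ 5 / k := by
    rw [div_le_div_iff₀ (by linarith) hk0]; linarith
  have h5 : 1 / (1 - b) ≤ 2 := by
    rw [div_le_iff₀ (by linarith)]; linarith
  have h6 : securedPayoff k = 1 / (1 - b) - 3 / ((k : ℝ) - 2) * (1 / (1 - b)) := by
    rw [securedPayoff]; ring
  rw [← one_div_one_sub_b, h6]
  have h7 : 3 / ((k : ℝ) - 2) * (1 / (1 - b)) ≤ 5 / k * 2 :=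
    mul_le_mul h4 h5 (one_div_nonneg.2 (by linarith)) (by positivity)
  have h8 : (5 : ℝ) / k * 2 = 10 / k := by ring
  linarith

/-! ### The edges of the adversary and integration against the strategy -/

theorem edge_fst_left (k : ℕ) (i j : Fin k) (s t : ℝ) : (edge k i j s t).1 i = s := by
  simp [edge]

theorem edge_fst_right {k : ℕ} {i j : Fin k} (hij : i ≠ j) (s t : ℝ) :
    (edge k i j s t).1 j = t := by
  simp [edge, hij.symm]

theorem edge_fst_other {k : ℕ} {i j l : Fin k} (hi : l ≠ i) (hj : l ≠ j) (s t : ℝ) :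
    (edge k i j s t).1 l = (1 - s - t) / ((k : ℝ) - 2) := by
  simp [edge, hi, hj]

theorem edge_snd (k : ℕ) (i j : Fin k) (s t : ℝ) :
    (edge k i j s t).2 = (edge k i j s t).1 - Pi.single i (ε k) + Pi.single j (ε k) := rfl

theorem edge_snd_left {k : ℕ} {i j : Fin k} (hij : i ≠ j) (s t : ℝ) :
    (edge k i j s t).2 i = s - ε k := by
  simp [edge_snd, edge_fst_left, hij]

theorem edge_snd_right {k : ℕ} {i j : Fin k} (hij : i ≠ j) (s t : ℝ) :
    (edge k i j s t).2 j = t + ε k := by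
  simp [edge_snd, edge_fst_right hij, hij.symm]

theorem edge_snd_other {k : ℕ} {i j l : Fin k} (hi : l ≠ i) (hj : l ≠ j) (s t : ℝ) :
    (edge k i j s t).2 l = (1 - s - t) / ((k : ℝ) - 2) := by
  simp [edge_snd, edge_fst_other hi hj, hi, hj]

theorem edgeLength_edge {k : ℕ} (hk : 5 ≤ k) {i j : Fin k} (hij : i ≠ j) (s t : ℝ) :
    edgeLength (edge k i j s t).1 (edge k i j s t).2 = ε k := by
  have hε := ε_pos hk
  have h : ∀ l, |(edge k i j s t).1 l - (edge k i j s t).2 l| =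
      (if l = i then ε k else 0) + (if l = j then ε k else 0) := by
    intro l
    by_cases hi : l = i
    · subst hi
      simp [edge_fst_left, edge_snd_left hij, hij, abs_of_pos hε]
    · by_cases hj : l = j
      · subst hj
        simp [edge_fst_right hij, edge_snd_right hij, hi, abs_of_pos hε]
      · simp [edge_fst_other hi hj, edge_snd_other hi hj, hi, hj]
  simp only [edgeLength, h, Finset.sum_add_distrib]
  simp
  ring

theorem edge_fst_mem {k : ℕ} (hk : 5 ≤ k) {i j : Fin k} (hij : i ≠ j) {s t : ℝ}
    (hs : 0 ≤ s) (ht : 0 ≤ t) (hst : s + t ≤ 1) :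
    (edge k i j s t).1 ∈ stdSimplex ℝ (Fin k) := by
  have h3 := three_le_cast_sub_two hk
  constructor
  · intro l
    by_cases hi : l = i
    · subst hi; rwa [edge_fst_left]
    · by_cases hj : l = j
      · subst hj; rwa [edge_fst_right hij]
      · rw [edge_fst_other hi hj]
        exact div_nonneg (by linarith) (by linarith)
  · have h : ∀ l, (edge k i j s t).1 l = (1 - s - t) / ((k : ℝ) - 2) +
        (if l = i then s - (1 - s - t) / ((k : ℝ) - 2) else 0) +
        (if l = j then t - (1 - s - t) / ((k : ℝ) - 2) else 0) := by
      intro l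
      by_cases hi : l = i
      · subst hi; simp [edge_fst_left, hij]
      · by_cases hj : l = j
        · subst hj; simp [edge_fst_right hij, hi]
        · simp [edge_fst_other hi hj, hi, hj]
    have h4 : (k : ℝ) - 2 ≠ 0 := by linarith
    simp only [h, Finset.sum_add_distrib]
    simp
    field_simp
    ring

theorem edge_snd_mem {k : ℕ} (hk : 5 ≤ k) {i j : Fin k} (hij : i ≠ j) {s t : ℝ}
    (hs : ε k ≤ s) (ht : 0 ≤ t) (hst : s + t ≤ 1) :
    (edge k i j s t).2 ∈ stdSimplex ℝ (Fin k) := by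
  have h3 := three_le_cast_sub_two hk
  have hε := ε_pos hk
  have h1 := edge_fst_mem hk hij (hε.le.trans hs) ht hst
  constructor
  · intro l
    by_cases hi : l = i
    · subst hi; rw [edge_snd_left hij]; linarith
    · by_cases hj : l = j
      · subst hj; rw [edge_snd_right hij]; linarith
      · rw [edge_snd_other hi hj]
        exact div_nonneg (by linarith) (by linarith)
  · rw [edge_snd]
    simp [Finset.sum_add_distrib, h1.2]

/-- A parametrization of edges is a measurable embedding as soon as some coordinate of the first
endpoint recovers the parameter. -/
theorem measurableEmbedding_of_edge_coord {k : ℕ} {i j l : Fin k} {u v : ℝ → ℝ}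
    (hu : Continuous u) (hv : Continuous v)
    (hinj : Function.Injective fun r => (edge k i j (u r) (v r)).1 l) :
    MeasurableEmbedding fun r => edge k i j (u r) (v r) := by
  have h1 : Continuous fun r => (edge k i j (u r) (v r)).1 := by
    refine continuous_pi fun m => ?_
    by_cases hi : m = i
    · subst hi; simpa only [edge_fst_left]
    · by_cases hj : m = j
      · subst hj; simpa only [edge_fst_right (Ne.symm hi)]
      · simp only [edge_fst_other hi hj]; fun_prop
  refine Continuous.measurableEmbedding (h1.prodMk ?_) fun r r' h => hinj ?_
  · exact (h1.sub continuous_const).add continuous_const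
  · exact congrFun (congrArg Prod.fst h) l

/-- The inclusion of the edges of the simplex in the pairs of vectors. -/
abbrev toVectors (k : ℕ) : Simplex k × Simplex k → (Fin k → ℝ) × (Fin k → ℝ) :=
  Prod.map Subtype.val Subtype.val

theorem measurableEmbedding_toVectors (k : ℕ) : MeasurableEmbedding (toVectors k) := by
  have h : MeasurableEmbedding (Subtype.val : Simplex k → Fin k → ℝ) :=
    MeasurableEmbedding.subtype_coe (isClosed_stdSimplex ℝ (Fin k)).measurableSet
  exact h.prodMap h

/-- The expectation over the three groups of edges of one ordered pair of terminals, of a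
quantity that takes the values `hA s`, `hB t`, `c` on them. -/
noncomputable def pairAverage (k : ℕ) (hA hB : ℝ → ℝ≥0∞) (c : ℝ≥0∞) : ℝ≥0∞ :=
  ENNReal.ofReal (massA k) * ∫⁻ s, hA s ∂(ProbabilityTheory.cond volume (Set.Icc (3 * b) 1)) +
    ENNReal.ofReal (massB k) * ∫⁻ t, hB t ∂(ProbabilityTheory.cond volume (Set.Icc 0 b)) +
    ENNReal.ofReal (massC k) * c

/-- Integration against the strategy. The function `f` is extended by zero outside the simplex; it
needs no measurability, because the parametrizations of the edges are measurable embeddings. -/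
theorem lintegral_strategy (k : ℕ) (f : Simplex k × Simplex k → ℝ≥0∞) :
    ∫⁻ e, f e ∂(strategy k) =
      ∑ ij ∈ (Finset.univ : Finset (Fin k)).offDiag,
        ENNReal.ofReal (1 / ((k : ℝ) * ((k : ℝ) - 1))) * pairAverage k
          (fun s => Function.extend (toVectors k) f 0 (edge k ij.1 ij.2 s 0))
          (fun t => Function.extend (toVectors k) f 0 (edge k ij.1 ij.2 (3 * b - 2 * t) t))
          (Function.extend (toVectors k) f 0 (edge k ij.1 ij.2 1 0)) := by
  have hι := measurableEmbedding_toVectors k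
  set g : (Fin k → ℝ) × (Fin k → ℝ) → ℝ≥0∞ := Function.extend (toVectors k) f 0
  have h1 : ∫⁻ e, f e ∂(strategy k) = ∫⁻ e, g e ∂(vectorDistribution k) := by
    have h2 : ∀ e, f e = g (toVectors k e) := fun e => (hι.injective.extend_apply f 0 e).symm
    simp_rw [h2]
    rw [← hι.lintegral_map, strategy, hι.map_comap, setLIntegral_eq_of_support_subset]
    intro v hv
    by_contra hv'
    exact hv (Function.extend_apply' f (0 : (Fin k → ℝ) × (Fin k → ℝ) → ℝ≥0∞) v hv')
  rw [h1, vectorDistribution, lintegral_finsetSum_measure]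
  refine Finset.sum_congr rfl fun ij hij => ?_
  have hne : ij.1 ≠ ij.2 := (Finset.mem_offDiag.1 hij).2.2
  have hA : MeasurableEmbedding fun s => edge k ij.1 ij.2 s 0 :=
    measurableEmbedding_of_edge_coord (l := ij.1) continuous_id continuous_const
      (by intro r r'; simp [edge_fst_left])
  have hB : MeasurableEmbedding fun t => edge k ij.1 ij.2 (3 * b - 2 * t) t :=
    measurableEmbedding_of_edge_coord (l := ij.2) (by fun_prop) continuous_id
      (by intro r r'; simp [edge_fst_right hne])
  rw [lintegral_smul_measure, lintegral_add_measure, lintegral_add_measure,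
    lintegral_smul_measure, lintegral_smul_measure, lintegral_smul_measure, uniformA, uniformB,
    diracC, lintegral_dirac, pairAverage, hA.lintegral_map, hB.lintegral_map]
  rfl

theorem pair_weights_sum {k : ℕ} (hk : 5 ≤ k) (q : ℝ≥0∞) :
    ∑ _ij ∈ (Finset.univ : Finset (Fin k)).offDiag,
      ENNReal.ofReal (1 / ((k : ℝ) * ((k : ℝ) - 1))) * q = q := by
  have h3 := three_le_cast_sub_two hk
  have hpos : 0 < (k : ℝ) * ((k : ℝ) - 1) := mul_pos (by linarith) (by linarith)
  have hcard : (((Finset.univ : Finset (Fin k)).offDiag.card : ℕ) : ℝ≥0∞) =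
      ENNReal.ofReal ((k : ℝ) * ((k : ℝ) - 1)) := by
    rw [← ENNReal.ofReal_natCast]
    congr 1
    rw [Finset.offDiag_card, Finset.card_univ, Fintype.card_fin,
      Nat.cast_sub (Nat.le_mul_self k), Nat.cast_mul]
    ring
  rw [Finset.sum_const, nsmul_eq_mul, hcard, ← mul_assoc, ← ENNReal.ofReal_mul hpos.le,
    mul_one_div_cancel hpos.ne', ENNReal.ofReal_one, one_mul]

theorem pairAverage_mono {k : ℕ} {hA hA' hB hB' : ℝ → ℝ≥0∞} {c c' : ℝ≥0∞}
    (h1 : ∀ s ∈ Set.Icc (3 * b) 1, hA s ≤ hA' s) (h2 : ∀ t ∈ Set.Icc 0 b, hB t ≤ hB' t)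
    (h3 : c ≤ c') : pairAverage k hA hB c ≤ pairAverage k hA' hB' c' := by
  unfold pairAverage
  refine add_le_add (add_le_add (mul_le_mul_right ?_ _) (mul_le_mul_right ?_ _))
    (mul_le_mul_right h3 _)
  · exact lintegral_mono_ae ((ProbabilityTheory.ae_cond_mem measurableSet_Icc).mono h1)
  · exact lintegral_mono_ae ((ProbabilityTheory.ae_cond_mem measurableSet_Icc).mono h2)

theorem pairAverage_const {k : ℕ} (hk : 5 ≤ k) (c : ℝ≥0∞) :
    pairAverage k (fun _ => c) (fun _ => c) c = c := by
  have h1 := b_lt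
  have h2 := b_gt
  have hp : ∀ u v : ℝ, u < v →
      IsProbabilityMeasure (ProbabilityTheory.cond volume (Set.Icc u v)) := fun u v huv =>
    ProbabilityTheory.cond_isProbabilityMeasure_of_finite (by simpa using huv) (by simp)
  have := hp (3 * b) 1 (by linarith)
  have := hp 0 b (by linarith)
  rw [pairAverage, lintegral_const, lintegral_const, measure_univ, measure_univ, mul_one, ← add_mul,
    ← add_mul, ← ENNReal.ofReal_add (massA_nonneg hk) (massB_nonneg hk),
    ← ENNReal.ofReal_add (add_nonneg (massA_nonneg hk) (massB_nonneg hk)) (massC_nonneg hk),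
    mass_sum hk, ENNReal.ofReal_one, one_mul]

theorem exists_toVectors_eq_edge {k : ℕ} (hk : 5 ≤ k) {i j : Fin k} (hij : i ≠ j) {s t : ℝ}
    (hs : b ≤ s) (ht : 0 ≤ t) (hst : s + t ≤ 1) :
    ∃ e, toVectors k e = edge k i j s t := by
  have h1 := b_gt
  have h2 := ε_lt hk
  exact ⟨(⟨_, edge_fst_mem hk hij (by linarith) ht hst⟩,
    ⟨_, edge_snd_mem hk hij (by linarith) ht hst⟩), rfl⟩

/-- A lower bound on the edges of each ordered pair, the same for all pairs, gives a lower bound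
for the integral against the strategy. -/
theorem le_lintegral_strategy {k : ℕ} (hk : 5 ≤ k) {f : Simplex k × Simplex k → ℝ≥0∞}
    {hA hB : ℝ → ℝ≥0∞} {c : ℝ≥0∞}
    (h1 : ∀ i j, i ≠ j → ∀ s ∈ Set.Icc (3 * b) 1, ∀ e, toVectors k e = edge k i j s 0 →
      hA s ≤ f e)
    (h2 : ∀ i j, i ≠ j → ∀ t ∈ Set.Icc 0 b, ∀ e, toVectors k e = edge k i j (3 * b - 2 * t) t →
      hB t ≤ f e)
    (h3 : ∀ i j, i ≠ j → ∀ e, toVectors k e = edge k i j 1 0 → c ≤ f e) :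
    pairAverage k hA hB c ≤ ∫⁻ e, f e ∂(strategy k) := by
  have hb := b_gt
  have hb' := b_lt
  have hι := (measurableEmbedding_toVectors k).injective
  rw [lintegral_strategy, ← pair_weights_sum hk (pairAverage k hA hB c)]
  refine Finset.sum_le_sum fun ij hij => ?_
  have hne : ij.1 ≠ ij.2 := (Finset.mem_offDiag.1 hij).2.2
  gcongr
  refine pairAverage_mono (fun s hs => ?_) (fun t ht => ?_) ?_
  · obtain ⟨e, he⟩ := exists_toVectors_eq_edge hk hne (s := s) (t := 0)
      (by linarith [hs.1]) le_rfl (by linarith [hs.2])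
    rw [← he, hι.extend_apply]
    exact h1 _ _ hne s hs e he
  · obtain ⟨e, he⟩ := exists_toVectors_eq_edge hk hne (s := 3 * b - 2 * t) (t := t)
      (by linarith [ht.2]) ht.1 (by linarith [ht.1])
    rw [← he, hι.extend_apply]
    exact h2 _ _ hne t ht e he
  · obtain ⟨e, he⟩ := exists_toVectors_eq_edge hk hne (s := 1) (t := 0)
      (by linarith) le_rfl (by linarith)
    rw [← he, hι.extend_apply]
    exact h3 _ _ hne e he

theorem lintegral_strategy_le {k : ℕ} (hk : 5 ≤ k) {f : Simplex k × Simplex k → ℝ≥0∞}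
    {c : ℝ≥0∞} (h : ∀ i j, i ≠ j → ∀ s t e, toVectors k e = edge k i j s t → f e ≤ c) :
    ∫⁻ e, f e ∂(strategy k) ≤ c := by
  have hg : ∀ i j, i ≠ j → ∀ s t, Function.extend (toVectors k) f 0 (edge k i j s t) ≤ c := by
    intro i j hij s t
    by_cases he : ∃ e, toVectors k e = edge k i j s t
    · obtain ⟨e, he⟩ := he
      rw [← he, (measurableEmbedding_toVectors k).injective.extend_apply]
      exact h i j hij s t e he
    · rw [Function.extend_apply' _ _ _ he]
      exact zero_le
  rw [lintegral_strategy, ← pair_weights_sum hk c]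
  refine Finset.sum_le_sum fun ij hij => ?_
  have hne : ij.1 ≠ ij.2 := (Finset.mem_offDiag.1 hij).2.2
  gcongr
  rw [← pairAverage_const hk c]
  exact pairAverage_mono (fun s _ => hg _ _ hne _ _) (fun t _ => hg _ _ hne _ _) (hg _ _ hne _ _)

theorem isProbabilityMeasure_strategy {k : ℕ} (hk : 5 ≤ k) :
    IsProbabilityMeasure (strategy k) := by
  refine ⟨?_⟩
  rw [← lintegral_one]
  refine le_antisymm (lintegral_strategy_le hk fun _ _ _ _ _ _ _ => le_rfl) ?_
  conv_lhs => rw [← pairAverage_const hk 1]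
  exact le_lintegral_strategy hk (fun _ _ _ _ _ _ _ => le_rfl) (fun _ _ _ _ _ _ _ => le_rfl)
    (fun _ _ _ _ _ => le_rfl)

/-! ### The payoff against Exponential Clocks -/

theorem exponentialClocks_cutProb_div_ge {k : ℕ} (hk : 5 ≤ k) {i j : Fin k} (hij : i ≠ j)
    {s t : ℝ} (hst : s + t ≤ 1) {e : Simplex k × Simplex k}
    (he : toVectors k e = edge k i j s t) :
    ENNReal.ofReal ((1 - ε k) * (2 - s - t)) ≤
      (exponentialClocks k).cutProb e.1 e.2 / ENNReal.ofReal (ε k) := by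
  have hε := ε_pos hk
  have h1 : (e.1 : Fin k → ℝ) = (edge k i j s t).1 := congrArg Prod.fst he
  have h2 : (e.2 : Fin k → ℝ) = (edge k i j s t).2 := congrArg Prod.snd he
  have h := exponentialClocks_cutProb_ge hij hε.le e.1 e.2 (by rw [h1, h2, edge_snd])
  rw [ENNReal.le_div_iff_mul_le (by simp [hε]) (by simp), mul_comm, ← ENNReal.ofReal_mul hε.le]
  refine le_trans (ENNReal.ofReal_le_ofReal (mul_le_mul_of_nonneg_left ?_ hε.le)) h
  have hi : e.1 i = s := by rw [h1, edge_fst_left]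
  have hj : e.1 j = t := by rw [h1, edge_fst_right hij]
  rw [hi, hj]
  have h3 : (1 - s - t) * (1 - ε k) ≤ (1 - s - t) / (1 + ε k) := by
    rw [le_div_iff₀ (by linarith)]
    nlinarith [mul_nonneg (by linarith : 0 ≤ 1 - s - t) (sq_nonneg (ε k))]
  linarith

theorem securedPayoff_le_exponentialClocks {k : ℕ} (hk : 5 ≤ k) :
    ENNReal.ofReal (securedPayoff k) ≤
      pairAverage k (fun s => ENNReal.ofReal ((1 - ε k) * (2 - s - 0)))
        (fun t => ENNReal.ofReal ((1 - ε k) * (2 - (3 * b - 2 * t) - t))) 0 := by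
  have hb := b_gt
  have hb' := b_lt
  have hε := ε_lt hk
  have hA0 := massA_nonneg hk
  have hB0 := massB_nonneg hk
  have e1 : ∀ s, (1 - ε k) * (2 - s - 0) = -(1 - ε k) * s + (1 - ε k) * 2 := fun s => by ring
  have e2 : ∀ t, (1 - ε k) * (2 - (3 * b - 2 * t) - t) =
      (1 - ε k) * t + (1 - ε k) * (2 - 3 * b) := fun t => by ring
  rw [pairAverage]
  simp only [e1, e2]
  rw [lintegral_cond_Icc_ofReal_affine (by linarith) (fun s hs => by
      rw [← e1]; exact mul_nonneg (by linarith) (by linarith [hs.2])),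
    lintegral_cond_Icc_ofReal_affine (by linarith) (fun t ht => by
      rw [← e2]; exact mul_nonneg (by linarith) (by linarith [ht.1])), mul_zero, add_zero,
    ← ENNReal.ofReal_mul hA0, ← ENNReal.ofReal_mul hB0, ← ENNReal.ofReal_add
      (mul_nonneg hA0 (by nlinarith)) (mul_nonneg hB0 (by nlinarith))]
  refine ENNReal.ofReal_le_ofReal ((securedPayoff_le_of_loss hk (ε_le hk)).trans ?_)
  have h1 : 0 < 1 - b := by linarith
  have hA := mul_le_mul_of_nonneg_right (massA_ge hk)
    (mul_nonneg (by linarith) (by linarith) : 0 ≤ (1 - ε k) * ((3 - 3 * b) / 2))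
  have hB := mul_le_mul_of_nonneg_right (massB_ge hk)
    (mul_nonneg (by linarith) (by linarith) : 0 ≤ (1 - ε k) * (2 - 5 / 2 * b))
  -- the constant `b` is the root of `b² + 4b = 1`, which makes the averages add up to `1`
  have key : (1 - 3 * b) / (1 - b) * ((3 - 3 * b) / 2) + 2 * b / (1 - b) * (2 - 5 / 2 * b) =
      1 / (1 - b) := by
    field_simp
    linarith [b_sq]
  calc (1 - 2 / ((k : ℝ) - 2)) * (1 - ε k) / (1 - b)
      = (1 - 2 / ((k : ℝ) - 2)) * ((1 - 3 * b) / (1 - b)) * ((1 - ε k) * ((3 - 3 * b) / 2)) +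
        (1 - 2 / ((k : ℝ) - 2)) * (2 * b / (1 - b)) * ((1 - ε k) * (2 - 5 / 2 * b)) := by
        linear_combination -(1 - 2 / ((k : ℝ) - 2)) * (1 - ε k) * key
    _ ≤ massA k * ((1 - ε k) * ((3 - 3 * b) / 2)) + massB k * ((1 - ε k) * (2 - 5 / 2 * b)) :=
        add_le_add hA hB
    _ = _ := by ring

/-! ### The payoff against Single Threshold -/

/-- `(1 - 1/k) / ε`: the payoff for an edge that leaves the threshold set of its terminal `i`. -/
noncomputable def leavePayoff (k : ℕ) : ℝ := (1 - 1 / k) / ε k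

/-- A lower bound for the payoff of the edge of `A` with parameter `u_i = s` against Single
Threshold with threshold `θ`. -/
noncomputable def thresholdPayoffA (k : ℕ) (θ s : ℝ) : ℝ≥0∞ :=
  if b < θ ∧ θ ≤ s ∧ s < θ + ε k then ENNReal.ofReal (leavePayoff k) else 0

/-- A lower bound for the payoff of the edge of `B` with parameter `u_j = t` against Single
Threshold with threshold `θ`. -/
noncomputable def thresholdPayoffB (k : ℕ) (θ t : ℝ) : ℝ≥0∞ :=
  if b < θ ∧ θ ≤ 3 * b - 2 * t ∧ 3 * b - 2 * t < θ + ε k then ENNReal.ofReal (leavePayoff k) else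
    if ε k < θ ∧ θ ≤ b ∧ θ ≤ t + ε k ∧ t < θ then ENNReal.ofReal (1 / 2 / ε k) else 0

/-- A lower bound for the payoff of the edge of `C` against Single Threshold with
threshold `θ`. -/
noncomputable def thresholdPayoffC (k : ℕ) (θ : ℝ) : ℝ≥0∞ :=
  if θ ≤ ε k then ENNReal.ofReal (1 / 2 / ε k) else
    if 1 - ε k < θ then ENNReal.ofReal (leavePayoff k) else 0

theorem leavePayoff_nonneg {k : ℕ} (hk : 5 ≤ k) : 0 ≤ leavePayoff k := by
  have := three_le_cast_sub_two hk
  refine div_nonneg (sub_nonneg.2 ?_) (ε_pos hk).le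
  rw [div_le_one (by linarith)]
  linarith

/-- The choice `ε = (1 - 2b) / (k - 2)`: on all the edges of the adversary `u_i + u_j ≥ 2b`, hence
the coordinates other than `i` and `j` are at most `ε`. -/
theorem other_coord_le {k : ℕ} (hk : 5 ≤ k) {s t : ℝ} (hst : 2 * b ≤ s + t) :
    (1 - s - t) / ((k : ℝ) - 2) ≤ ε k := by
  have := three_le_cast_sub_two hk
  exact div_le_div_of_nonneg_right (by linarith) (by linarith)

theorem leavePayoff_le {k : ℕ} (hk : 5 ≤ k) {i j : Fin k} (hij : i ≠ j) {s t θ : ℝ}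
    {e : Simplex k × Simplex k} (he : toVectors k e = edge k i j s t) (hst : 2 * b ≤ s + t)
    (htb : t ≤ b) (hbθ : b < θ) (h1 : θ ≤ s) (h2 : s < θ + ε k) :
    ENNReal.ofReal (leavePayoff k) ≤ thresholdCutProb θ e.1 e.2 / ENNReal.ofReal (ε k) := by
  have hε := ε_pos hk
  have hε' := ε_lt hk
  have hb := b_gt
  have hx : ∀ l, e.1 l = (edge k i j s t).1 l := fun l => congrFun (congrArg Prod.fst he) l
  have hy : ∀ l, e.2 l = (edge k i j s t).2 l := fun l => congrFun (congrArg Prod.snd he) l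
  rw [leavePayoff, ENNReal.ofReal_div_of_pos hε]
  refine ENNReal.div_le_div_right (thresholdCutProb_ge_of_leave (i := i) ?_ ?_ ?_) _
  · rwa [hx, edge_fst_left]
  · rw [hy, edge_snd_left hij]; linarith
  · intro l hl
    rw [hx]
    by_cases hj : l = j
    · subst hj; rw [edge_fst_right hij]; linarith
    · rw [edge_fst_other hl hj]
      linarith [other_coord_le hk hst]

theorem enterPayoff_le {k : ℕ} (hk : 5 ≤ k) {i j : Fin k} (hij : i ≠ j) {s t θ : ℝ}
    {e : Simplex k × Simplex k} (he : toVectors k e = edge k i j s t)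
    (hst : (1 - s - t) / ((k : ℝ) - 2) < θ) (h1 : θ ≤ t + ε k) (h2 : t < θ) :
    ENNReal.ofReal (1 / 2 / ε k) ≤ thresholdCutProb θ e.1 e.2 / ENNReal.ofReal (ε k) := by
  have hε := ε_pos hk
  have hx : ∀ l, e.1 l = (edge k i j s t).1 l := fun l => congrFun (congrArg Prod.fst he) l
  have hy : ∀ l, e.2 l = (edge k i j s t).2 l := fun l => congrFun (congrArg Prod.snd he) l
  rw [ENNReal.ofReal_div_of_pos hε]
  refine ENNReal.div_le_div_right (thresholdCutProb_ge_of_enter hij ?_ ?_ ?_) _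
  · rwa [hx, edge_fst_right hij]
  · rwa [hy, edge_snd_right hij]
  · intro l hi hj
    rwa [hy, edge_snd_other hi hj]

theorem thresholdPayoffA_le {k : ℕ} (hk : 5 ≤ k) {i j : Fin k} (hij : i ≠ j) {s θ : ℝ}
    (hs : 3 * b ≤ s) {e : Simplex k × Simplex k} (he : toVectors k e = edge k i j s 0) :
    thresholdPayoffA k θ s ≤ thresholdCutProb θ e.1 e.2 / ENNReal.ofReal (ε k) := by
  have hb := b_gt
  unfold thresholdPayoffA
  split_ifs with h
  · exact leavePayoff_le hk hij he (by linarith) (by linarith) h.1 h.2.1 h.2.2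
  · exact zero_le

theorem thresholdPayoffB_le {k : ℕ} (hk : 5 ≤ k) {i j : Fin k} (hij : i ≠ j) {t θ : ℝ}
    (htb : t ≤ b) {e : Simplex k × Simplex k}
    (he : toVectors k e = edge k i j (3 * b - 2 * t) t) :
    thresholdPayoffB k θ t ≤ thresholdCutProb θ e.1 e.2 / ENNReal.ofReal (ε k) := by
  unfold thresholdPayoffB
  split_ifs with h h
  · exact leavePayoff_le hk hij he (by linarith) htb h.1 h.2.1 h.2.2
  · exact enterPayoff_le hk hij he ((other_coord_le hk (by linarith)).trans_lt h.1) h.2.2.1 h.2.2.2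
  · exact zero_le

theorem thresholdPayoffC_le {k : ℕ} (hk : 5 ≤ k) {i j : Fin k} (hij : i ≠ j) {θ : ℝ}
    (hθ : 0 < θ) (hθ1 : θ ≤ 1) {e : Simplex k × Simplex k}
    (he : toVectors k e = edge k i j 1 0) :
    thresholdPayoffC k θ ≤ thresholdCutProb θ e.1 e.2 / ENNReal.ofReal (ε k) := by
  have hb := b_gt
  have hb' := b_lt
  have hε := ε_lt hk
  unfold thresholdPayoffC
  split_ifs with h h
  · exact enterPayoff_le hk hij he (by simpa) (by linarith) hθ
  · exact leavePayoff_le hk hij he (by linarith) (by linarith) (by linarith) hθ1 (by linarith)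
  · exact zero_le

theorem measurable_thresholdPayoffA (k : ℕ) :
    Measurable fun p : ℝ × ℝ => thresholdPayoffA k p.1 p.2 := by
  refine Measurable.ite ?_ measurable_const measurable_const
  simp only [Set.ofPred_and]
  exact (measurableSet_lt (by fun_prop) (by fun_prop)).inter
    ((measurableSet_le (by fun_prop) (by fun_prop)).inter
      (measurableSet_lt (by fun_prop) (by fun_prop)))

theorem measurable_thresholdPayoffB (k : ℕ) :
    Measurable fun p : ℝ × ℝ => thresholdPayoffB k p.1 p.2 := by
  refine Measurable.ite ?_ measurable_const (Measurable.ite ?_ measurable_const measurable_const)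
  · simp only [Set.ofPred_and]
    exact (measurableSet_lt (by fun_prop) (by fun_prop)).inter
      ((measurableSet_le (by fun_prop) (by fun_prop)).inter
        (measurableSet_lt (by fun_prop) (by fun_prop)))
  · simp only [Set.ofPred_and]
    exact (measurableSet_lt (by fun_prop) (by fun_prop)).inter
      ((measurableSet_le (by fun_prop) (by fun_prop)).inter
        ((measurableSet_le (by fun_prop) (by fun_prop)).inter
          (measurableSet_lt (by fun_prop) (by fun_prop))))

theorem measurable_thresholdPayoffC (k : ℕ) : Measurable (thresholdPayoffC k) :=
  Measurable.ite (measurableSet_le (by fun_prop) (by fun_prop)) measurable_const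
    (Measurable.ite (measurableSet_lt (by fun_prop) (by fun_prop)) measurable_const
      measurable_const)

/-- If, for the threshold `θ`, edges of `A` of total length `x`, and edges of `B` in a parameter
set of length `y`, leave the threshold set, with `x + 2 y ≥ ε`, then the payoff is secured. -/
theorem securedPayoff_le_of_leave {k : ℕ} (hk : 5 ≤ k) {x y : ℝ} (hx : 0 ≤ x) (hy : 0 ≤ y)
    (hxy : ε k ≤ x + 2 * y) :
    securedPayoff k ≤ massA k * (leavePayoff k * (x / (1 - 3 * b))) +
      massB k * (leavePayoff k * (y / b)) := by
  have hb := b_gt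
  have hb' := b_lt
  have hε := ε_pos hk
  have h3 := three_le_cast_sub_two hk
  have hκ := leavePayoff_nonneg hk
  have hγ := one_sub_two_div_pos hk
  have hd : 1 / (k : ℝ) ≤ 1 / ((k : ℝ) - 2) :=
    one_div_le_one_div_of_le (by linarith) (by linarith)
  refine (securedPayoff_le_of_loss hk hd).trans ?_
  have hA := mul_le_mul_of_nonneg_right (massA_ge hk)
    (mul_nonneg hκ (div_nonneg hx (by linarith)) : 0 ≤ leavePayoff k * (x / (1 - 3 * b)))
  have hB := mul_le_mul_of_nonneg_right (massB_ge hk)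
    (mul_nonneg hκ (div_nonneg hy (by linarith)) : 0 ≤ leavePayoff k * (y / b))
  refine le_trans ?_ (add_le_add hA hB)
  have h1 : 1 - b ≠ 0 := by linarith
  have h2 : 1 - 3 * b ≠ 0 := by linarith
  have h4 : b ≠ 0 := by linarith
  have e1 : (1 - 2 / ((k : ℝ) - 2)) * (1 - 1 / (k : ℝ)) / (1 - b) =
      (1 - 2 / ((k : ℝ) - 2)) / (1 - b) * leavePayoff k * ε k := by
    rw [leavePayoff]; field_simp
  have e2 : (1 - 2 / ((k : ℝ) - 2)) * ((1 - 3 * b) / (1 - b)) *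
      (leavePayoff k * (x / (1 - 3 * b))) + (1 - 2 / ((k : ℝ) - 2)) * (2 * b / (1 - b)) *
      (leavePayoff k * (y / b)) =
      (1 - 2 / ((k : ℝ) - 2)) / (1 - b) * leavePayoff k * (x + 2 * y) := by
    generalize (1 - 2 / ((k : ℝ) - 2)) = γ
    field_simp
  rw [e1, e2]
  exact mul_le_mul_of_nonneg_left hxy (mul_nonneg (div_nonneg hγ.le (by linarith)) hκ)

theorem securedPayoff_le_singleThreshold {k : ℕ} (hk : 5 ≤ k) {θ : ℝ} :
    ENNReal.ofReal (securedPayoff k) ≤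
      pairAverage k (thresholdPayoffA k θ) (thresholdPayoffB k θ) (thresholdPayoffC k θ) := by
  have hb := b_gt
  have hb' := b_lt
  have hε := ε_pos hk
  have hε' := ε_lt hk
  have hκ := leavePayoff_nonneg hk
  have hA0 := massA_nonneg hk
  have hB0 := massB_nonneg hk
  have hC0 := massC_nonneg hk
  have h1b : 0 < 1 - b := by linarith
  have hγ := one_sub_two_div_pos hk
  have hone : securedPayoff k ≤ (1 - 2 / ((k : ℝ) - 2)) / (1 - b) := by
    have h3 := three_le_cast_sub_two hk
    simpa using securedPayoff_le_of_loss hk (d := 0) (one_div_nonneg.2 (by linarith))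
  have hone' : securedPayoff k ≤ 1 / (1 - b) := by
    refine hone.trans (div_le_div_of_nonneg_right ?_ h1b.le)
    have h3 := three_le_cast_sub_two hk
    have : 0 ≤ 2 / ((k : ℝ) - 2) := div_nonneg (by norm_num) (by linarith)
    linarith
  -- the edges of `A` and `B` that leave the threshold set
  have hAB : ∀ x y uA vA uB vB : ℝ, b < θ → vA - uA = x → vB - uB = y → 0 ≤ x → 0 ≤ y →
      ε k ≤ x + 2 * y → Set.Ioo uA vA ⊆ Set.Icc (3 * b) 1 → Set.Ioo uB vB ⊆ Set.Icc 0 b →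
      (∀ s ∈ Set.Ioo uA vA, θ ≤ s ∧ s < θ + ε k) →
      (∀ t ∈ Set.Ioo uB vB, θ ≤ 3 * b - 2 * t ∧ 3 * b - 2 * t < θ + ε k) →
      ENNReal.ofReal (securedPayoff k) ≤
        pairAverage k (thresholdPayoffA k θ) (thresholdPayoffB k θ) (thresholdPayoffC k θ) := by
    intro x y uA vA uB vB hθ hx hy hx0 hy0 hxy hA hB hA' hB'
    have h1 := le_lintegral_cond_Icc (by linarith) hκ hA (h := thresholdPayoffA k θ)
      (fun s hs => by rw [thresholdPayoffA, if_pos ⟨hθ, hA' s hs⟩])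
    have h2 := le_lintegral_cond_Icc (by linarith) hκ hB (h := thresholdPayoffB k θ)
      (fun t ht => by rw [thresholdPayoffB, if_pos ⟨hθ, hB' t ht⟩])
    rw [hx] at h1
    rw [hy, sub_zero] at h2
    refine (ENNReal.ofReal_le_ofReal (securedPayoff_le_of_leave hk hx0 hy0 hxy)).trans ?_
    rw [ENNReal.ofReal_add (mul_nonneg hA0 (mul_nonneg hκ (div_nonneg hx0 (by linarith))))
      (mul_nonneg hB0 (mul_nonneg hκ (div_nonneg hy0 (by linarith)))), ENNReal.ofReal_mul hA0,
      ENNReal.ofReal_mul hB0]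
    exact le_add_right (add_le_add (mul_le_mul_right h1 _) (mul_le_mul_right h2 _))
  rcases le_or_gt θ (ε k) with h1 | h1
  · -- the edge `C` enters the threshold set of `j`
    have : ENNReal.ofReal (securedPayoff k) ≤
        ENNReal.ofReal (massC k) * thresholdPayoffC k θ := by
      rw [thresholdPayoffC, if_pos h1, ← ENNReal.ofReal_mul hC0, massC_eq]
      refine ENNReal.ofReal_le_ofReal (hone'.trans_eq ?_)
      field_simp
    exact this.trans le_add_self
  rcases le_or_gt θ b with h2 | h2
  · -- edges of `B` enter the threshold set of `j`
    have h3 := le_lintegral_cond_Icc (u := θ - ε k) (v := θ) (a := 0) (b := b) (by linarith)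
      (by positivity : 0 ≤ 1 / 2 / ε k)
      (fun t ht => ⟨by linarith [ht.1], by linarith [ht.2]⟩) (h := thresholdPayoffB k θ)
      (fun t ht => by
        rw [thresholdPayoffB, if_neg (fun h => absurd h.1 (not_lt.2 h2)),
          if_pos ⟨h1, h2, by linarith [ht.1], ht.2⟩])
    have : ENNReal.ofReal (securedPayoff k) ≤ ENNReal.ofReal (massB k) *
        ∫⁻ t, thresholdPayoffB k θ t ∂(ProbabilityTheory.cond volume (Set.Icc 0 b)) := by
      refine le_trans ?_ (mul_le_mul_right h3 _)
      rw [← ENNReal.ofReal_mul hB0]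
      refine ENNReal.ofReal_le_ofReal (hone.trans ?_)
      have e : 1 / 2 / ε k * ((θ - (θ - ε k)) / (b - 0)) = 1 / (2 * b) := by
        rw [sub_zero, sub_sub_cancel]; field_simp
      rw [e]
      refine le_trans (le_of_eq ?_) (mul_le_mul_of_nonneg_right (massB_ge hk) (by positivity))
      generalize (1 - 2 / ((k : ℝ) - 2)) = γ
      field_simp
    exact this.trans (le_add_right le_add_self)
  rcases le_or_gt θ (3 * b - ε k) with h3 | h3
  · -- only edges of `B` leave, with `2 u_j ∈ (3b - θ - ε, 3b - θ]`
    refine hAB 0 (ε k / 2) 1 1 ((3 * b - θ - ε k) / 2) ((3 * b - θ) / 2) h2 (by ring) (by ring)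
      le_rfl (by positivity) (by linarith) (by simp) ?_ (by simp) ?_
    · exact fun t ht => ⟨by linarith [ht.1], by linarith [ht.2]⟩
    · exact fun t ht => ⟨by linarith [ht.2], by linarith [ht.1]⟩
  rcases le_or_gt θ (3 * b) with h4 | h4
  · -- the window `[θ, θ + ε)` for `u_i` contains `3b`, where `A` and `B` meet
    refine hAB (θ + ε k - 3 * b) ((3 * b - θ) / 2) (3 * b) (θ + ε k) 0 ((3 * b - θ) / 2) h2
      (by ring) (by ring) (by linarith) (by linarith) (by linarith) ?_ ?_ ?_ ?_
    · exact fun s hs => ⟨by linarith [hs.1], by linarith [hs.2]⟩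
    · exact fun t ht => ⟨by linarith [ht.1], by linarith [ht.2]⟩
    · exact fun s hs => ⟨by linarith [hs.1], by linarith [hs.2]⟩
    · exact fun t ht => ⟨by linarith [ht.2], by linarith [ht.1]⟩
  rcases le_or_gt θ (1 - ε k) with h5 | h5
  · -- only edges of `A` leave
    refine hAB (ε k) 0 θ (θ + ε k) 0 0 h2 (by ring) (by ring) hε.le le_rfl (by linarith)
      ?_ (by simp) ?_ (by simp)
    · exact fun s hs => ⟨by linarith [hs.1], by linarith [hs.2]⟩
    · exact fun s hs => ⟨by linarith [hs.1], by linarith [hs.2]⟩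
  · -- the edge `C` leaves the threshold set of `i`
    have : ENNReal.ofReal (securedPayoff k) ≤
        ENNReal.ofReal (massC k) * thresholdPayoffC k θ := by
      have h3 := three_le_cast_sub_two hk
      have hk2 : 1 / (k : ℝ) ≤ 1 / 2 := one_div_le_one_div_of_le (by norm_num) (by linarith)
      rw [thresholdPayoffC, if_neg (by linarith), if_pos h5, ← ENNReal.ofReal_mul hC0, massC_eq]
      refine ENNReal.ofReal_le_ofReal (hone'.trans ?_)
      have e : 2 * ε k / (1 - b) * leavePayoff k = 2 * (1 - 1 / (k : ℝ)) / (1 - b) := by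
        rw [leavePayoff]; field_simp
      rw [e]
      exact div_le_div_of_nonneg_right (by linarith) h1b.le
    exact this.trans le_add_self

/-! ### The payoff against the combination -/

theorem lintegral_pairAverage {k : ℕ} {Θ : Type*} [MeasurableSpace Θ] (μ : Measure Θ) [SFinite μ]
    {hA hB : Θ → ℝ → ℝ≥0∞} {c : Θ → ℝ≥0∞} (h1 : Measurable (Function.uncurry hA))
    (h2 : Measurable (Function.uncurry hB)) (h3 : Measurable c) :
    ∫⁻ θ, pairAverage k (hA θ) (hB θ) (c θ) ∂μ =
      pairAverage k (fun s => ∫⁻ θ, hA θ s ∂μ) (fun t => ∫⁻ θ, hB θ t ∂μ) (∫⁻ θ, c θ ∂μ) := by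
  have hmA : ∀ S : Set ℝ, Measurable fun θ => ∫⁻ s, hA θ s ∂(ProbabilityTheory.cond volume S) :=
    fun S => h1.lintegral_prod_right'
  have hmB : ∀ S : Set ℝ, Measurable fun θ => ∫⁻ s, hB θ s ∂(ProbabilityTheory.cond volume S) :=
    fun S => h2.lintegral_prod_right'
  simp only [pairAverage]
  rw [lintegral_add_right _ (h3.const_mul _), lintegral_add_right _ ((hmB _).const_mul _),
    lintegral_const_mul _ (hmA _), lintegral_const_mul _ (hmB _), lintegral_const_mul _ h3,
    lintegral_lintegral_swap h1.aemeasurable, lintegral_lintegral_swap h2.aemeasurable]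

theorem pairAverage_add_mul {k : ℕ} {hA hB hA' hB' : ℝ → ℝ≥0∞} {c c' : ℝ≥0∞} (p q : ℝ≥0∞)
    (h1 : Measurable hA) (h2 : Measurable hB) (h1' : Measurable hA') (h2' : Measurable hB') :
    pairAverage k (fun s => p * hA s + q * hA' s) (fun t => p * hB t + q * hB' t)
      (p * c + q * c') = p * pairAverage k hA hB c + q * pairAverage k hA' hB' c' := by
  simp only [pairAverage]
  rw [lintegral_add_left (h1.const_mul _), lintegral_add_left (h2.const_mul _),
    lintegral_const_mul _ h1, lintegral_const_mul _ h2, lintegral_const_mul _ h1',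
    lintegral_const_mul _ h2']
  ring

/-- Lower bounds for the payoffs against the two schemes combine to one against the combination. -/
theorem le_combination_cutProb_div {k : ℕ} (hk : 5 ≤ k) (p : unitInterval)
    (μ : Measure (Set.Ioc (0 : ℝ) 1)) [IsProbabilityMeasure μ] {i j : Fin k} (hij : i ≠ j)
    {s t : ℝ} {e : Simplex k × Simplex k} (he : toVectors k e = edge k i j s t) {a : ℝ≥0∞}
    {m : Set.Ioc (0 : ℝ) 1 → ℝ≥0∞}
    (ha : a ≤ (exponentialClocks k).cutProb e.1 e.2 / ENNReal.ofReal (ε k))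
    (hm : ∀ θ, m θ ≤ thresholdCutProb (θ : ℝ) e.1 e.2 / ENNReal.ofReal (ε k)) :
    ENNReal.ofReal p * a + ENNReal.ofReal (1 - p) * ∫⁻ θ, m θ ∂μ ≤
      (combination k p μ).cutProb e.1 e.2 /
        ENNReal.ofReal (edgeLength (e.1 : Fin k → ℝ) e.2) := by
  have h1 : (e.1 : Fin k → ℝ) = (edge k i j s t).1 := congrArg Prod.fst he
  have h2 : (e.2 : Fin k → ℝ) = (edge k i j s t).2 := congrArg Prod.snd he
  rw [h1, h2, edgeLength_edge hk hij, combination, mix_cutProb, singleThreshold_cutProb,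
    ENNReal.add_div, mul_div_assoc, mul_div_assoc]
  refine add_le_add (mul_le_mul_right ha _) (mul_le_mul_right ?_ _)
  simp only [div_eq_mul_inv] at hm ⊢
  rw [← lintegral_mul_const' _ _ (ENNReal.inv_ne_top.2 (by simpa using ε_pos hk))]
  exact lintegral_mono hm

theorem securedPayoff_le_expectedPayoff {k : ℕ} (hk : 5 ≤ k) (p : unitInterval)
    (μ : Measure (Set.Ioc (0 : ℝ) 1)) [IsProbabilityMeasure μ] :
    ENNReal.ofReal (securedPayoff k) ≤ expectedPayoff (combination k p μ) (strategy k) := by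
  have hb := b_gt
  have hb' := b_lt
  have hp : ENNReal.ofReal p + ENNReal.ofReal (1 - p) = 1 := by
    rw [← ENNReal.ofReal_add p.2.1 (by linarith [p.2.2])]
    simp
  have hmA : Measurable (Function.uncurry fun (θ : Set.Ioc (0 : ℝ) 1) s =>
      thresholdPayoffA k θ s) :=
    (measurable_thresholdPayoffA k).comp
      ((measurable_subtype_coe.comp measurable_fst).prodMk measurable_snd)
  have hmB : Measurable (Function.uncurry fun (θ : Set.Ioc (0 : ℝ) 1) s =>
      thresholdPayoffB k θ s) :=
    (measurable_thresholdPayoffB k).comp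
      ((measurable_subtype_coe.comp measurable_fst).prodMk measurable_snd)
  have hmC : Measurable fun θ : Set.Ioc (0 : ℝ) 1 => thresholdPayoffC k θ :=
    (measurable_thresholdPayoffC k).comp measurable_subtype_coe
  have hST : ENNReal.ofReal (securedPayoff k) ≤
      pairAverage k (fun s => ∫⁻ θ : Set.Ioc (0 : ℝ) 1, thresholdPayoffA k θ s ∂μ)
        (fun t => ∫⁻ θ : Set.Ioc (0 : ℝ) 1, thresholdPayoffB k θ t ∂μ)
        (∫⁻ θ : Set.Ioc (0 : ℝ) 1, thresholdPayoffC k θ ∂μ) := by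
    rw [← lintegral_pairAverage μ hmA hmB hmC]
    calc ENNReal.ofReal (securedPayoff k) = ∫⁻ _θ : Set.Ioc (0 : ℝ) 1,
          ENNReal.ofReal (securedPayoff k) ∂μ := by simp
      _ ≤ _ := lintegral_mono fun θ => securedPayoff_le_singleThreshold hk
  calc ENNReal.ofReal (securedPayoff k)
      = ENNReal.ofReal p * ENNReal.ofReal (securedPayoff k) +
        ENNReal.ofReal (1 - p) * ENNReal.ofReal (securedPayoff k) := by
        rw [← add_mul, hp, one_mul]
    _ ≤ _ := add_le_add (mul_le_mul_right (securedPayoff_le_exponentialClocks hk) _)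
        (mul_le_mul_right hST _)
    _ = _ := (pairAverage_add_mul _ _ (by fun_prop) (by fun_prop) hmA.lintegral_prod_left'
        hmB.lintegral_prod_left').symm
    _ ≤ _ := by
        refine le_lintegral_strategy hk (fun i j hij s hs e he => ?_) (fun i j hij t ht e he => ?_)
          (fun i j hij e he => ?_)
        · exact le_combination_cutProb_div hk p μ hij he
            (exponentialClocks_cutProb_div_ge hk hij (by linarith [hs.2]) he)
            (fun θ => thresholdPayoffA_le hk hij hs.1 he)
        · exact le_combination_cutProb_div hk p μ hij he
            (exponentialClocks_cutProb_div_ge hk hij (by linarith [ht.1]) he)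
            (fun θ => thresholdPayoffB_le hk hij ht.2 he)
        · exact le_combination_cutProb_div hk p μ hij he zero_le
            (fun θ => thresholdPayoffC_le hk hij θ.2.1 θ.2.2 he)

end Adversary

namespace RoundingScheme

/-! ### From approximation factors and cut densities to cut probabilities -/

/-- The instance with a single edge, of weight one: an approximation factor bounds each cut
probability. -/
theorem AchievesFactor.cutProb_le {k : ℕ} {R : RoundingScheme k} {α : ℝ≥0}
    (h : R.AchievesFactor α) (x y : Simplex k) :
    R.cutProb x y ≤ α * ENNReal.ofReal (edgeLength (x : Fin k → ℝ) y) := by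
  let I : MultiwayCut k :=
    { V := Fin k ⊕ Bool
      E := {(Sum.inr false, Sum.inr true)}
      weight := fun _ => 1
      terminal := ⟨Sum.inl, Sum.inl_injective⟩ }
  let pos : I.V → Simplex k := fun v => match v with
    | Sum.inl t => ⟨Pi.single t 1, single_mem_stdSimplex ℝ t⟩
    | Sum.inr false => x
    | Sum.inr true => y
  have h1 := h I pos fun t => rfl
  have h2 : I.objective pos = ENNReal.ofReal (edgeLength (x : Fin k → ℝ) y) := by
    simp [MultiwayCut.objective, I, pos]
  have h3 : ∀ ω, I.cutWeight (fun v => R.label ω (pos v)) =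
      {ω | R.label ω x ≠ R.label ω y}.indicator 1 ω := by
    intro ω
    simp [MultiwayCut.cutWeight, I, pos, Set.indicator_apply]
  simp_rw [h2, h3] at h1
  rwa [lintegral_indicator_one (R.measurableSet_cut x y)] at h1

theorem cutProb_self {k : ℕ} (R : RoundingScheme k) (x : Simplex k) : R.cutProb x x = 0 := by
  simp [cutProb]

theorem cutProb_comm {k : ℕ} (R : RoundingScheme k) (x y : Simplex k) :
    R.cutProb x y = R.cutProb y x := by
  simp only [cutProb, ne_comm]

theorem cutProb_triangle {k : ℕ} (R : RoundingScheme k) (x y z : Simplex k) :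
    R.cutProb x z ≤ R.cutProb x y + R.cutProb y z := by
  refine (measure_mono fun ω hω => ?_).trans (measure_union_le _ _)
  by_cases h : R.label ω x = R.label ω y
  · exact Or.inr fun h' => hω (h.trans h')
  · exact Or.inl h

/-- A bound on the cut density bounds the cut probabilities of the short edges. -/
theorem exists_cutProb_le_of_cutDensity_lt {k : ℕ} {R : RoundingScheme k} {i j : Fin k}
    {x : Simplex k} {β : ℝ≥0∞} (h : R.cutDensity i j x < β) :
    ∃ δ > 0, ∀ (d : ℝ) (y : Simplex k), 0 < d → d < δ →
      (y : Fin k → ℝ) = (x : Fin k → ℝ) + Pi.single i d - Pi.single j d →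
      R.cutProb x y ≤ β * ENNReal.ofReal d := by
  have hev := eventually_lt_of_limsup_lt h
  rw [eventually_comap, Metric.eventually_nhds_iff] at hev
  obtain ⟨δ, hδ, hev⟩ := hev
  refine ⟨δ, hδ, fun d y hd hdδ hy => ?_⟩
  have := hev (y := d) (by simpa [abs_of_pos hd] using hdδ) ⟨d, hd, hy ▸ y.2⟩ rfl
  have he : (⟨(x : Fin k → ℝ) + Pi.single i d - Pi.single j d, hy ▸ y.2⟩ : Simplex k) = y :=
    Subtype.ext hy.symm
  rw [he] at this
  exact (ENNReal.div_le_iff (by simpa using hd) ENNReal.ofReal_ne_top).1 this.le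

/-- Subdividing an edge into short ones: if `G` is subadditive along the interval `[0, L]` and
locally, on both sides of each point, at most `β` times the length, then so it is globally. -/
theorem le_mul_of_locally_le {G : ℝ → ℝ → ℝ≥0∞} {L : ℝ} (hL : 0 ≤ L) {β : ℝ≥0∞}
    (hself : G 0 0 = 0) (htri : ∀ a b c, 0 ≤ a → a ≤ b → b ≤ c → c ≤ L → G a c ≤ G a b + G b c)
    (hloc : ∀ a, 0 ≤ a → a ≤ L → ∃ δ > 0, (∀ c, a < c → c < a + δ → c ≤ L →
      G a c ≤ β * ENNReal.ofReal (c - a)) ∧ (∀ c, 0 ≤ c → c < a → a - δ < c →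
      G c a ≤ β * ENNReal.ofReal (a - c))) :
    G 0 L ≤ β * ENNReal.ofReal L := by
  -- the supremum of the points up to which the bound holds is a maximum, and equal to `L`
  let S : Set ℝ := {a | 0 ≤ a ∧ a ≤ L ∧ G 0 a ≤ β * ENNReal.ofReal a}
  have h0 : (0 : ℝ) ∈ S := ⟨le_rfl, hL, by simp [hself]⟩
  have hbdd : BddAbove S := ⟨L, fun a ha => ha.2.1⟩
  have hstep : ∀ a c, a ∈ S → a ≤ c → c ≤ L → G a c ≤ β * ENNReal.ofReal (c - a) → c ∈ S := by
    intro a c ha hac hcL h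
    refine ⟨ha.1.trans hac, hcL, (htri 0 a c le_rfl ha.1 hac hcL).trans
      ((add_le_add ha.2.2 h).trans_eq ?_)⟩
    rw [← mul_add, ← ENNReal.ofReal_add ha.1 (sub_nonneg.2 hac), add_sub_cancel]
  set T := sSup S
  have hT0 : 0 ≤ T := le_csSup hbdd h0
  have hTL : T ≤ L := csSup_le ⟨0, h0⟩ fun a ha => ha.2.1
  obtain ⟨δ, hδ, hright, hleft⟩ := hloc T hT0 hTL
  have hTS : T ∈ S := by
    obtain ⟨a, ha, haT⟩ := exists_lt_of_lt_csSup ⟨0, h0⟩ (sub_lt_self T hδ)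
    obtain h | h := (le_csSup hbdd ha).eq_or_lt
    · rwa [h] at ha
    · exact hstep a T ha h.le hTL (hleft a ha.1 h haT)
  obtain h | h := hTL.eq_or_lt
  · rw [← h]; exact hTS.2.2
  · have hc1 : T < min L (T + δ / 2) := lt_min h (by linarith)
    have hc2 : min L (T + δ / 2) < T + δ := (min_le_right _ _).trans_lt (by linarith)
    have := le_csSup hbdd (hstep T _ hTS hc1.le (min_le_left _ _)
      (hright _ hc1 hc2 (min_le_left _ _)))
    exact absurd this (not_le.2 hc1)

/-- If the cut densities of the types `(i, j)` and `(j, i)` are at most `α`, then the cut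
probability of an edge of type `(i, j)` is at most `α` times its length. -/
theorem cutProb_le_of_cutDensity_le {k : ℕ} {R : RoundingScheme k} {α : ℝ≥0∞} {i j : Fin k}
    (hij : ∀ x, R.cutDensity i j x ≤ α) (hji : ∀ x, R.cutDensity j i x ≤ α) {d : ℝ} (hd : 0 ≤ d)
    (x y : Simplex k)
    (hxy : (y : Fin k → ℝ) = (x : Fin k → ℝ) + Pi.single i d - Pi.single j d) :
    R.cutProb x y ≤ α * ENNReal.ofReal d := by
  have hmem : ∀ a, 0 ≤ a → a ≤ d →
      (x : Fin k → ℝ) + Pi.single i a - Pi.single j a ∈ stdSimplex ℝ (Fin k) := by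
    intro a ha had
    obtain rfl | hd' := hd.eq_or_lt
    · obtain rfl := le_antisymm had ha
      rw [← hxy]; exact y.2
    have hconv : (x : Fin k → ℝ) + Pi.single i a - Pi.single j a =
        (1 - a / d) • (x : Fin k → ℝ) + (a / d) • (y : Fin k → ℝ) := by
      have hs : ∀ l : Fin k, (Pi.single l a : Fin k → ℝ) = (a / d) • Pi.single l d := by
        intro l
        rw [← Pi.single_smul, smul_eq_mul, div_mul_cancel₀ _ hd'.ne']
      rw [hxy, hs i, hs j]
      module
    rw [hconv]
    exact convex_stdSimplex ℝ (Fin k) x.2 y.2 (sub_nonneg.2 ((div_le_one hd').2 had))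
      (div_nonneg ha hd'.le) (by ring)
  let pt : ℝ → Simplex k := fun a => if h : 0 ≤ a ∧ a ≤ d then ⟨_, hmem a h.1 h.2⟩ else x
  have hpt : ∀ a, 0 ≤ a → a ≤ d →
      (pt a : Fin k → ℝ) = (x : Fin k → ℝ) + Pi.single i a - Pi.single j a := by
    intro a ha had
    simp only [pt, dif_pos (And.intro ha had)]
    rfl
  have hx : pt 0 = x := DFunLike.coe_injective (by rw [hpt 0 le_rfl hd]; simp)
  have hy : pt d = y := DFunLike.coe_injective (by rw [hpt d hd le_rfl, hxy])
  obtain rfl | hd' := hd.eq_or_lt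
  · rw [← hx, ← hy, cutProb_self]; exact zero_le
  rw [← ENNReal.div_le_iff (by simpa using hd') ENNReal.ofReal_ne_top]
  refine le_of_forall_gt_imp_ge_of_dense fun β hβ => ?_
  rw [ENNReal.div_le_iff (by simpa using hd') ENNReal.ofReal_ne_top, ← hx, ← hy]
  refine le_mul_of_locally_le (G := fun a c => R.cutProb (pt a) (pt c)) hd (R.cutProb_self _)
    (fun a b c _ _ _ _ => R.cutProb_triangle _ _ _) fun a ha had => ?_
  obtain ⟨δ₁, hδ₁, h₁⟩ := exists_cutProb_le_of_cutDensity_lt ((hij (pt a)).trans_lt hβ)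
  obtain ⟨δ₂, hδ₂, h₂⟩ := exists_cutProb_le_of_cutDensity_lt ((hji (pt a)).trans_lt hβ)
  refine ⟨min δ₁ δ₂, lt_min hδ₁ hδ₂, fun c hac hc hcd => ?_, fun c hc0 hca hc => ?_⟩
  · refine h₁ (c - a) (pt c) (sub_pos.2 hac) (by linarith [min_le_left δ₁ δ₂]) ?_
    rw [hpt a ha had, hpt c (by linarith) hcd, Pi.single_sub, Pi.single_sub]
    abel
  · rw [cutProb_comm]
    refine h₂ (a - c) (pt c) (sub_pos.2 hca) (by linarith [min_le_right δ₁ δ₂]) ?_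
    rw [hpt a ha had, hpt c hc0 (by linarith), Pi.single_sub, Pi.single_sub]
    abel

end RoundingScheme

namespace Adversary

/-! ### Upper bounds for the expected payoff -/

theorem expectedPayoff_le_of_achievesFactor {k : ℕ} (hk : 5 ≤ k) {R : RoundingScheme k} {α : ℝ≥0}
    (h : R.AchievesFactor α) : expectedPayoff R (strategy k) ≤ α :=
  lintegral_strategy_le hk fun _ _ _ _ _ e _ => ENNReal.div_le_of_le_mul (h.cutProb_le e.1 e.2)

theorem expectedPayoff_le_of_cutDensity_le {k : ℕ} (hk : 5 ≤ k) {R : RoundingScheme k} {α : ℝ≥0∞}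
    (h : ∀ i j : Fin k, i ≠ j → ∀ x : Simplex k, R.cutDensity i j x ≤ α) :
    expectedPayoff R (strategy k) ≤ α := by
  refine lintegral_strategy_le hk fun i j hij s t e he => ENNReal.div_le_of_le_mul ?_
  have h1 : (e.1 : Fin k → ℝ) = (edge k i j s t).1 := congrArg Prod.fst he
  have h2 : (e.2 : Fin k → ℝ) = (edge k i j s t).2 := congrArg Prod.snd he
  have hlen : edgeLength (e.1 : Fin k → ℝ) e.2 = ε k := by
    rw [h1, h2, edgeLength_edge hk hij]
  rw [hlen]
  -- the edge moves mass from `i` to `j`, so that it is an edge of type `(j, i)`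
  refine RoundingScheme.cutProb_le_of_cutDensity_le (h j i hij.symm) (h i j hij) (ε_pos hk).le
    e.1 e.2 ?_
  rw [h1, h2, edge_snd]
  abel

theorem target_le_of_expectedPayoff_le {k : ℕ} (hk : 5 ≤ k) {p : unitInterval}
    {μ : Measure (Set.Ioc (0 : ℝ) 1)} [IsProbabilityMeasure μ] {α : ℝ≥0}
    (h : expectedPayoff (combination k p μ) (strategy k) ≤ α) :
    (3 + √5) / 4 - 10 / k ≤ α := by
  refine (target_le_securedPayoff hk).trans ?_
  have := (securedPayoff_le_expectedPayoff hk p μ).trans h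
  rw [← ENNReal.ofReal_coe_nnreal] at this
  exact (ENNReal.ofReal_le_ofReal_iff α.2).1 this

end Adversary

theorem mainTheorem4 :
    (∀ α : ℝ≥0, (α : ℝ) < (3 + √5) / 4 → ∃ K : ℕ, ∀ k : ℕ, K ≤ k →
      ∀ (p : unitInterval) (μ : Measure (Set.Ioc (0 : ℝ) 1)) [IsProbabilityMeasure μ],
        ¬ (combination k p μ).AchievesFactor α) ∧
    (∀ k : ℕ, 5 ≤ k → IsProbabilityMeasure (Adversary.strategy k)) ∧
    ∃ C : ℝ, ∀ k : ℕ, 5 ≤ k →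
      ∀ (p : unitInterval) (μ : Measure (Set.Ioc (0 : ℝ) 1)) [IsProbabilityMeasure μ],
        ENNReal.ofReal ((3 + √5) / 4 - C / k) ≤
            expectedPayoff (combination k p μ) (Adversary.strategy k) ∧
        (∀ α : ℝ≥0, (combination k p μ).AchievesFactor α → (3 + √5) / 4 - C / k ≤ α) ∧
        (∀ α : ℝ≥0, (∀ (i j : Fin k), i ≠ j → ∀ x : Simplex k,
          (combination k p μ).cutDensity i j x ≤ α) → (3 + √5) / 4 - C / k ≤ α) := by
  refine ⟨fun α hα => ?_, fun k hk => Adversary.isProbabilityMeasure_strategy hk, 10,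
    fun k hk p μ _ => ⟨?_, fun α h => ?_, fun α h => ?_⟩⟩
  · obtain ⟨n, hn⟩ := exists_nat_gt (10 / ((3 + √5) / 4 - α))
    refine ⟨max 5 n, fun k hk p μ _ h => ?_⟩
    have hk5 : 5 ≤ k := (le_max_left _ _).trans hk
    have hk0 : (0 : ℝ) < k := by exact_mod_cast (by omega : 0 < k)
    have hnk : (n : ℝ) ≤ k := by exact_mod_cast (le_max_right _ _).trans hk
    have h1 := Adversary.target_le_of_expectedPayoff_le hk5
      (Adversary.expectedPayoff_le_of_achievesFactor hk5 h)
    have h2 : 10 / (k : ℝ) < (3 + √5) / 4 - α := (div_lt_comm₀ (sub_pos.2 hα) hk0).1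
      (hn.trans_le hnk)
    linarith
  · exact (ENNReal.ofReal_le_ofReal (Adversary.target_le_securedPayoff hk)).trans
      (Adversary.securedPayoff_le_expectedPayoff hk p μ)
  · exact Adversary.target_le_of_expectedPayoff_le hk
      (Adversary.expectedPayoff_le_of_achievesFactor hk h)
  · exact Adversary.target_le_of_expectedPayoff_le hk
      (Adversary.expectedPayoff_le_of_cutDensity_le hk h)
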